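/- Let $d$ be a dimension and $\|\cdot\|$ a norm on $\mathbb{R}^d$. For $L>0$ and $t\ge 1$ put $\Delta=L^{-2/(d+2)}t^{-1/(d+2)}$. **The algorithm (contextual smooth Beta process, CSBP).** The input consists of experiments $\mathcal S=\{(x_i,s_i,A_i,B_i)\}_{i=1,\dots,t}$ with $x_i\in[0,1]^d$, $s_i\in\{0,1\}$, $A_i=1-B_i$, $B_i\in[0,1]$, and a query point $x\in[0,1]^d$ with uniform prior $\mathrm{Beta}(1,1)$. Let $n$ be the number of indices $i$ with $\|x-x_i\|\le\Delta$, let $S$ be the number of successes ($s_i=1$) among these, and let $B_x$ be the average of the corresponding $B_i$. The output is the distribution $$\tilde\pi(x|\mathcal S)\sim\sum_{i=0}^{n}C_i\,\mathrm{Beta}(1+i,\,1+n-i),\qquad C_i\propto\binom{S}{i}\,i!\,(n-i)!\,B_x^{\,S-i}\ \ (0\le i\le S),\qquad C_i=0\ \ (i>S),\qquad \sum_i C_i=1,$$ which is the Bayesian posterior when all $n$ experiments are treated as independent Bernoulli tests with success probability $(1-B_x)\theta+B_x$, $\theta$ being the unknown value at $x$; if $n=0$ it is the prior. **The model.** Let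 $\pi:[0,1]^d\to(0,1]$ be $L$-Lipschitz for $\|\cdot\|$, with $L>0$, and let $B_1,\dots,B_t\in[0,1]$ be fixed numbers, not all equal to $1$. The points $x_i$ are i.i.d. uniform on $[0,1]^d$; the noises $\epsilon_i$ are real random variables with mean zero and variance $\sigma^2$; all the $x_i$ and $\epsilon_i$ are independent; and, given the $x_i$ and $\epsilon_i$, the outcomes $s_i$ are independent with $$s_i\sim\mathrm{Bernoulli}\bigl((1-(B_i+\epsilon_i))\pi(x_i)+B_i+\epsilon_i\bigr).$$ The algorithm is given $\mathcal S=\{(x_i,s_i,1-B_i,B_i)\}_{i=1,\dots,t}$; the noises are not observed. **Theorem.** (a) There is a finite constant $c(B,\sigma^2)$ that depends only on $d$, on the norm, on $\sigma^2$ and on the average $\frac1t\sum_{i=1}^tB_i$ (in particular not on $t$ otherwise, nor on $L$, $\pi$, $x$ or the laws of the $\epsilon_i$), such that in this model, whenever $t\ge L^{-2}$ (that is, $\Delta\le1$), $$\sup_{x\in[0,1]^d}\mathbb{E}_{\mathcal S}\Bigl[\mathbb{E}\bigl[(\tilde\pi(x|\mathcal S)-\pi(x))^2\bigr]\Bigr]\le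 c(B,\sigma^2)\,L^{\frac{2d}{d+2}}\,t^{-\frac{2}{d+2}},$$ where the inner expectation is over $\tilde\pi(x|\mathcal S)$ and the outer one over the points, the noises and the outcomes. (b) The posterior at a query point is computed in time $O(t)$: for each $d$ and each norm there are a program for a unit-cost real random-access machine (one step for each arithmetic operation or power of reals, each comparison, each memory access, each elementary operation on an index, and each evaluation of the norm of the difference of two stored points) and a constant $K$ such that for every $t\ge1$, $L>0$, query point $x$ and input $\mathcal S$ as above the program halts after at most $Kt$ steps and outputs $n$ and the weights $C_0,\dots,C_n$ of $\tilde\pi(x|\mathcal S)$. -/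

import Mathlib

open MeasureTheory ProbabilityTheory

noncomputable section

namespace CSBP

/-! ### Experiments and the algorithm -/

/-- The description `(xᵢ, sᵢ, Aᵢ, Bᵢ)` of one Bernoulli test at the point `xᵢ ∈ ℝ^d`, with outcome
`sᵢ` (`true` is success) and contextual parameters `Aᵢ`, `Bᵢ`: the success probability is modelled
as `Aᵢ * π xᵢ + Bᵢ`. -/
structure Experiment (d : ℕ) where
  point : Fin d → ℝ
  outcome : Bool
  A : ℝ
  B : ℝ

/-- The kernel width `Δ = L ^ (-2/(d+2)) * t ^ (-1/(d+2))`. -/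
def bandwidth (d : ℕ) (L : ℝ) (t : ℕ) : ℝ :=
  L ^ (-2 / ((d : ℝ) + 2)) * (t : ℝ) ^ (-1 / ((d : ℝ) + 2))

/-- One step of the Bayesian update for the parameter `θ` of a success probability `A θ + B`:
from the weights `C 0, …, C n` of the mixture `∑ i ≤ n, C i • Beta(α + i, β + n - i)` to the
unnormalised weights of index `0, …, n + 1` after one more outcome `s`. -/
def bayesStep (α β A B : ℝ) (n : ℕ) (C : ℕ → ℝ) (s : Bool) (i : ℕ) : ℝ :=
  let stay : ℝ := if i ≤ n then C i * (β + n - i) else 0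
  let move : ℝ := if i = 0 then 0 else C (i - 1) * (α + i - 1)
  if s then B * stay + (A + B) * move else (1 - B) * stay + (1 - A - B) * move

/-- The normalised weights of the Bayesian posterior mixture after a list of outcomes (the last
outcome is the head of the list), all obtained with the same parameters `A` and `B`. -/
def bayesCoeff (α β A B : ℝ) : List Bool → ℕ → ℝ
  | [], i => if i = 0 then 1 else 0
  | s :: l, i =>
      bayesStep α β A B l.length (bayesCoeff α β A B l) s i /
        ∑ j ∈ Finset.range (l.length + 2), bayesStep α β A B l.length (bayesCoeff α β A B l) s j

/-- Unnormalised posterior weights when `A = 1 - B`, after `k` successes among `n` outcomes. -/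
def simpleWeight (α β B : ℝ) (n k i : ℕ) : ℝ :=
  (k.choose i : ℝ) * Real.Gamma (α + i) * Real.Gamma (β + n - i) * B ^ (k - i)

/-- Normalised posterior weights when `A = 1 - B`, after `k` successes among `n` outcomes. -/
def simpleCoeff (α β B : ℝ) (n k i : ℕ) : ℝ :=
  simpleWeight α β B n k i / ∑ j ∈ Finset.range (k + 1), simpleWeight α β B n k j

section Algorithm

variable {d t : ℕ} (N : Seminorm ℝ (Fin d → ℝ)) (Δ : ℝ) (S : Fin t → Experiment d) (x : Fin d → ℝ)

open Classical in
/-- The indices of the experiments performed within distance `Δ` of the query point `x`. -/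
def neighbors : Finset (Fin t) :=
  Finset.univ.filter fun i => N (x - (S i).point) ≤ Δ

/-- The number of neighbouring experiments. -/
def neighborCount : ℕ := (neighbors N Δ S x).card

/-- The number of successes among the neighbouring experiments. -/
def successCount : ℕ := ((neighbors N Δ S x).filter fun i => (S i).outcome = true).card

/-- The mean of the parameters `Aᵢ` over the neighbourhood. -/
def meanA : ℝ := (∑ i ∈ neighbors N Δ S x, (S i).A) / neighborCount N Δ S x

/-- The mean of the parameters `Bᵢ` over the neighbourhood. -/
def meanB : ℝ := (∑ i ∈ neighbors N Δ S x, (S i).B) / neighborCount N Δ S x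

/-- The outcomes of the neighbouring experiments, the last one first. -/
def neighborOutcomes : List Bool :=
  (((neighbors N Δ S x).sort (· ≤ ·)).map fun i => (S i).outcome).reverse

open Classical in
/-- The weights of the posterior mixture at `x` that the contextual smooth Beta process computes,
for the prior `Beta(α, β)` at `x`: all neighbouring experiments are treated as if performed at `x`
with the averaged parameters. Without neighbours the only nonzero weight is that of the prior. -/
def coeff (α β : ℝ) (i : ℕ) : ℝ :=
  if meanA N Δ S x + meanB N Δ S x = 1 then
    simpleCoeff α β (meanB N Δ S x) (neighborCount N Δ S x) (successCount N Δ S x) i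
  else
    bayesCoeff α β (meanA N Δ S x) (meanB N Δ S x) (neighborOutcomes N Δ S x) i

/-- The posterior distribution of the contextual smooth Beta process at the query point `x`, for
the prior `Beta(α x, β x)`, as a measure on `ℝ`. -/
def posterior (α β : (Fin d → ℝ) → ℝ) : Measure ℝ :=
  ∑ i ∈ Finset.range (neighborCount N Δ S x + 1),
    ENNReal.ofReal (coeff N Δ S x (α x) (β x) i) •
      betaMeasure (α x + i) (β x + neighborCount N Δ S x - i)

end Algorithm

/-! ### The statistical model -/

/-- The general contextual setting with noisy contextual parameters: the points `X i` are uniform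
on the cube `[0,1]^d`; the noise `ε i` has mean zero and variance `σ ^ 2` and is independent of
`X i`; given `X i` and `ε i`, the outcome `s i` is Bernoulli with parameter
`(1 - (B i + ε i)) * π (X i) + (B i + ε i)`; and the experiments are mutually independent. -/
structure NoisyModel {d t : ℕ} {Ω : Type*} [MeasurableSpace Ω] (P : Measure Ω)
    (π : (Fin d → ℝ) → ℝ) (B : Fin t → ℝ) (σ : ℝ)
    (X : Fin t → Ω → Fin d → ℝ) (ε : Fin t → Ω → ℝ) (s : Fin t → Ω → Bool) : Prop where
  measurable_point : ∀ i, Measurable (X i)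
  measurable_noise : ∀ i, Measurable (ε i)
  measurable_outcome : ∀ i, Measurable (s i)
  indep : iIndepFun (fun i ω => (X i ω, ε i ω, s i ω)) P
  uniform : ∀ i, P.map (X i) = volume.restrict (Set.Icc (0 : Fin d → ℝ) 1)
  indep_noise : ∀ i, IndepFun (X i) (ε i) P
  memLp_noise : ∀ i, MemLp (ε i) 2 P
  noise_mean : ∀ i, ∫ ω, ε i ω ∂P = 0
  noise_variance : ∀ i, variance (ε i) P = σ ^ 2
  bernoulli : ∀ i,
    P⟦s i ⁻¹' {true} | MeasurableSpace.comap (fun ω => (X i ω, ε i ω)) inferInstance⟧ =ᵐ[P]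
      fun ω => (1 - (B i + ε i ω)) * π (X i ω) + (B i + ε i ω)

/-! ### A real random-access machine with unit costs -/

/-- Arithmetic operations on reals that take one step. -/
inductive ArithOp
  | add | sub | mul | div | pow

/-- The value of an arithmetic operation. -/
def ArithOp.eval : ArithOp → ℝ → ℝ → ℝ
  | .add, a, b => a + b
  | .sub, a, b => a - b
  | .mul, a, b => a * b
  | .div, a, b => a / b
  | .pow, a, b => a ^ b

/-- The memory: index registers, real registers, arrays of reals, and an array of points. -/
structure Memory (d : ℕ) where
  idx : ℕ → ℕ
  reg : ℕ → ℝ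
  arr : ℕ → ℕ → ℝ
  pts : ℕ → Fin d → ℝ

/-- Programs. Registers and arrays are named by fixed numbers; array positions are read from index
registers. An index register can only be set to a constant, to a successor or to a predecessor. -/
inductive Program
  | idxConst (a c : ℕ)
  | idxSucc (a b : ℕ)
  | idxPred (a b : ℕ)
  | regConst (r : ℕ) (q : ℚ)
  | regOfIdx (r a : ℕ)
  | regOp (o : ArithOp) (r p q : ℕ)
  | load (r k a : ℕ)
  | store (k a r : ℕ)
  | dist (r a b : ℕ)
  | seq (P Q : Program)
  | ifIdxLe (a b : ℕ) (P Q : Program)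
  | ifRegLe (p q : ℕ) (P Q : Program)
  | whileIdxLt (a b : ℕ) (P : Program)

/-- `Runs N P m n m'`: program `P`, started in memory `m`, halts after exactly `n` steps in memory
`m'`. Each basic instruction and each test takes one step, including the evaluation of the norm `N`
of the difference of two stored points of `ℝ^d` (`d` being fixed). -/
inductive Runs {d : ℕ} (N : Seminorm ℝ (Fin d → ℝ)) :
    Program → Memory d → ℕ → Memory d → Prop
  | idxConst (a c : ℕ) (m : Memory d) :
      Runs N (.idxConst a c) m 1 { m with idx := Function.update m.idx a c }
  | idxSucc (a b : ℕ) (m : Memory d) :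
      Runs N (.idxSucc a b) m 1 { m with idx := Function.update m.idx a (m.idx b + 1) }
  | idxPred (a b : ℕ) (m : Memory d) :
      Runs N (.idxPred a b) m 1 { m with idx := Function.update m.idx a (m.idx b - 1) }
  | regConst (r : ℕ) (q : ℚ) (m : Memory d) :
      Runs N (.regConst r q) m 1 { m with reg := Function.update m.reg r (q : ℝ) }
  | regOfIdx (r a : ℕ) (m : Memory d) :
      Runs N (.regOfIdx r a) m 1 { m with reg := Function.update m.reg r (m.idx a : ℝ) }
  | regOp (o : ArithOp) (r p q : ℕ) (m : Memory d) :
      Runs N (.regOp o r p q) m 1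
        { m with reg := Function.update m.reg r (o.eval (m.reg p) (m.reg q)) }
  | load (r k a : ℕ) (m : Memory d) :
      Runs N (.load r k a) m 1 { m with reg := Function.update m.reg r (m.arr k (m.idx a)) }
  | store (k a r : ℕ) (m : Memory d) :
      Runs N (.store k a r) m 1
        { m with arr := Function.update m.arr k
                          (Function.update (m.arr k) (m.idx a) (m.reg r)) }
  | dist (r a b : ℕ) (m : Memory d) :
      Runs N (.dist r a b) m 1
        { m with reg := Function.update m.reg r (N (m.pts (m.idx a) - m.pts (m.idx b))) }
  | seq {P Q : Program} {m₀ m₁ m₂ : Memory d} {n₁ n₂ : ℕ}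
      (h₁ : Runs N P m₀ n₁ m₁) (h₂ : Runs N Q m₁ n₂ m₂) :
      Runs N (.seq P Q) m₀ (n₁ + n₂) m₂
  | ifIdxLe_true {a b : ℕ} {P Q : Program} {m m' : Memory d} {n : ℕ}
      (h : m.idx a ≤ m.idx b) (hP : Runs N P m n m') :
      Runs N (.ifIdxLe a b P Q) m (n + 1) m'
  | ifIdxLe_false {a b : ℕ} {P Q : Program} {m m' : Memory d} {n : ℕ}
      (h : ¬ m.idx a ≤ m.idx b) (hQ : Runs N Q m n m') :
      Runs N (.ifIdxLe a b P Q) m (n + 1) m'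
  | ifRegLe_true {p q : ℕ} {P Q : Program} {m m' : Memory d} {n : ℕ}
      (h : m.reg p ≤ m.reg q) (hP : Runs N P m n m') :
      Runs N (.ifRegLe p q P Q) m (n + 1) m'
  | ifRegLe_false {p q : ℕ} {P Q : Program} {m m' : Memory d} {n : ℕ}
      (h : ¬ m.reg p ≤ m.reg q) (hQ : Runs N Q m n m') :
      Runs N (.ifRegLe p q P Q) m (n + 1) m'
  | while_stop {a b : ℕ} {P : Program} {m : Memory d}
      (h : ¬ m.idx a < m.idx b) :
      Runs N (.whileIdxLt a b P) m 1 m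
  | while_step {a b : ℕ} {P : Program} {m₀ m₁ m₂ : Memory d} {n₁ n₂ : ℕ}
      (h : m₀.idx a < m₀.idx b) (hP : Runs N P m₀ n₁ m₁)
      (hW : Runs N (.whileIdxLt a b P) m₁ n₂ m₂) :
      Runs N (.whileIdxLt a b P) m₀ (n₁ + n₂ + 1) m₂

/-- The input: `t` in index register `0`, `L` in real register `0`, the query point `x` at position
`0` and the points `xᵢ` at the positions `i + 1` of the array of points, the outcomes (as `0` or
`1`) and the parameters `Aᵢ`, `Bᵢ` in the arrays `0`, `1`, `2`; everything else is zero. -/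
def input {d t : ℕ} (L : ℝ) (S : Fin t → Experiment d) (x : Fin d → ℝ) : Memory d where
  idx a := if a = 0 then t else 0
  reg r := if r = 0 then L else 0
  arr k i :=
    if h : i < t then
      match k with
      | 0 => if (S ⟨i, h⟩).outcome then 1 else 0
      | 1 => (S ⟨i, h⟩).A
      | 2 => (S ⟨i, h⟩).B
      | _ => 0
    else 0
  pts i := if i = 0 then x else if h : i - 1 < t then (S ⟨i - 1, h⟩).point else 0

/-- The memory `m` holds the posterior mixture at `x` for the uniform prior `Beta(1, 1)`: the number
`n` of neighbours in index register `0`, and the weights of the components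
`Beta(1 + i, 1 + n - i)`, `i = 0, …, n`, in the array `0`. -/
def HoldsPosterior {d t : ℕ} (N : Seminorm ℝ (Fin d → ℝ)) (Δ : ℝ) (S : Fin t → Experiment d)
    (x : Fin d → ℝ) (m : Memory d) : Prop :=
  m.idx 0 = neighborCount N Δ S x ∧ ∀ i ≤ neighborCount N Δ S x, m.arr 0 i = coeff N Δ S x 1 1 i

end CSBP

end

/-! Risk bound. With `n` neighbours, `k` successes and mean parameter `B`, the mixture has density
proportional to `g(θ) = (1 - θ)^(n-k) * ((1 - B)θ + B)^k` on `(0, 1)`, by the binomial theorem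
(`sum_simpleCoeff_mul_betaPDFReal`). This `g` is log-concave, with enough curvature at its mode that
one integration by parts bounds the mean square distance to the mode by `1 / W`, where `W = n(1 -
B)` (`integral_sq_sub_mode_mul_likelihood_le`). The mode is explicit, so its distance to `q = π x`
is at most `|∑ (sᵢ - ((1 - Bᵢ)q + Bᵢ))| / W`, summed over the neighbours, and `W = ∑ (1 - Bᵢ)`:
averaging the `Bᵢ` loses nothing.

The last sum splits into a centred part `E` and a bias of at most `W L Δ`. The success probability
is affine in the noise, which has mean zero and is independent of the point, so the first moments
are those of the noiseless model (`integral_mul_outcome`). Outcomes are binary, so second moments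
reduce to first ones, and the variance of `E` is at most `μ`, the mean of `W`. By Chebyshev, `W >
μ/2` outside an event of probability at most `4/μ`, on which the error is at most one. Altogether
the risk is at most `24/μ + 4(LΔ)²`. Since a ball of radius `Δ ≤ 1` about a point of the cube has
mass at least a constant times `Δ^d` in the cube, and `Δ^(d+2) L² t = 1`, both terms are of order
`(LΔ)²`, which is the claimed rate.

Running time. Relative to the top weight `C k`, the weight of index `k - j` is `choose (n-k+j) j *
B^j`, which satisfies a one-step recursion in `j` (`relWeight_succ`). One pass over the data and
three passes over the weights suffice, each with constant work per entry; loop invariants verify the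
program. -/

namespace CSBP

/-! ### Log-concavity and concentration of the posterior density -/

/-- The unnormalised posterior density of `θ` after `k` successes and `m` failures of independent
tests with success probability `(1 - B) * θ + B`. -/
noncomputable def likelihood (B : ℝ) (m k : ℕ) (θ : ℝ) : ℝ :=
  (1 - θ) ^ m * ((1 - B) * θ + B) ^ k

theorem continuous_likelihood (B : ℝ) (m k : ℕ) : Continuous (likelihood B m k) := by
  unfold likelihood; fun_prop

theorem likelihood_nonneg {B θ : ℝ} (m k : ℕ) (hB : 0 ≤ B) (hB' : B ≤ 1) (h0 : 0 ≤ θ)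
    (h1 : θ ≤ 1) : 0 ≤ likelihood B m k θ := by
  have : 0 ≤ (1 - B) * θ := mul_nonneg (by linarith) h0
  exact mul_nonneg (pow_nonneg (by linarith) _) (pow_nonneg (by linarith) _)

/-- The derivative of the likelihood. -/
noncomputable def likelihoodDeriv (B : ℝ) (m k : ℕ) (θ : ℝ) : ℝ :=
  (m * (1 - θ) ^ (m - 1) * (-1)) * ((1 - B) * θ + B) ^ k +
    (1 - θ) ^ m * (k * ((1 - B) * θ + B) ^ (k - 1) * (1 - B))

theorem hasDerivAt_likelihood (B : ℝ) (m k : ℕ) (θ : ℝ) :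
    HasDerivAt (likelihood B m k) (likelihoodDeriv B m k θ) θ := by
  have h1 : HasDerivAt (fun θ : ℝ => (1 - θ) ^ m) (m * (1 - θ) ^ (m - 1) * (-1)) θ := by
    simpa using ((hasDerivAt_id' θ).const_sub 1).fun_pow m
  have h2 : HasDerivAt (fun θ : ℝ => ((1 - B) * θ + B) ^ k)
      (k * ((1 - B) * θ + B) ^ (k - 1) * (1 - B)) θ := by
    simpa using (((hasDerivAt_id' θ).const_mul (1 - B)).add_const B).fun_pow k
  exact h1.mul h2

theorem continuous_likelihoodDeriv (B : ℝ) (m k : ℕ) : Continuous (likelihoodDeriv B m k) := by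
  unfold likelihoodDeriv; fun_prop

/-- The factor `m` hides the truncation of `m - 1` at `m = 0`. -/
theorem natCast_mul_pow_pred (m : ℕ) (x : ℝ) : (m : ℝ) * x ^ (m - 1) * x = m * x ^ m := by
  cases m with
  | zero => simp
  | succ m => rw [Nat.add_sub_cancel, pow_succ, mul_assoc]

/-- With `p = (1 - B)θ + B` one has `(1 - B)(1 - θ) = 1 - p`, so the logarithmic derivative `-m/(1 -
θ) + k(1 - B)/p` becomes `k - (m + k)p` once its denominators are cleared. -/
theorem likelihoodDeriv_mul (B : ℝ) (m k : ℕ) (θ : ℝ) :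
    likelihoodDeriv B m k θ * (((1 - B) * θ + B) * (1 - θ)) =
      likelihood B m k θ * (k - (m + k) * ((1 - B) * θ + B)) := by
  have h1 := natCast_mul_pow_pred m (1 - θ)
  have h2 := natCast_mul_pow_pred k ((1 - B) * θ + B)
  unfold likelihoodDeriv likelihood
  linear_combination (-((1 - B) * θ + B) ^ k * ((1 - B) * θ + B)) * h1 +
    ((1 - θ) ^ m * (1 - B) * (1 - θ)) * h2

/-- The posterior mode, clamped to `[0, 1]`. -/
noncomputable def likelihoodMode (B : ℝ) (m k : ℕ) : ℝ :=
  max 0 ((k - (m + k) * B) / ((m + k) * (1 - B)))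

theorem likelihoodMode_nonneg (B : ℝ) (m k : ℕ) : 0 ≤ likelihoodMode B m k := le_max_left _ _

/-- Only the lower end needs clamping: `k ≤ m + k` already keeps the unclamped value below one. -/
theorem likelihoodMode_le_one {B : ℝ} {m k : ℕ} (hB' : B < 1) (hn : 0 < m + k) :
    likelihoodMode B m k ≤ 1 := by
  have hn' : (0 : ℝ) < m + k := by exact_mod_cast hn
  refine max_le zero_le_one ?_
  rw [div_le_one (mul_pos hn' (by linarith))]
  have : (0 : ℝ) ≤ m := m.cast_nonneg
  linarith

/-- Projection onto `[0, ∞)` fixes `q` and does not increase distances. -/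
theorem abs_likelihoodMode_sub_le {B q : ℝ} {m k : ℕ} (hq : 0 ≤ q) :
    |likelihoodMode B m k - q| ≤ |(k - (m + k) * B) / ((m + k) * (1 - B)) - q| := by
  unfold likelihoodMode
  rcases le_total 0 ((k - (m + k) * B) / ((m + k) * (1 - B))) with h | h
  · rw [max_eq_right h]
  · rw [max_eq_left h, zero_sub, abs_neg, abs_of_nonneg hq, abs_of_nonpos (by linarith)]
    linarith

/-- Quantitative log-concavity. For an unclamped mode `θ*`, `(m + k)p - k` equals `(m + k)(1 - B)(θ
- θ*)`; if the mode is clamped to `0`, the discarded term has the favourable sign. The formula for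
the derivative carries a factor `p(1 - θ)` in `(0, 1]`, which may be dropped because the quantity it
multiplies is nonnegative. -/
theorem sq_mul_likelihood_le {B θ : ℝ} {m k : ℕ} (hB : 0 ≤ B) (hB' : B < 1) (hn : 0 < m + k)
    (h0 : 0 < θ) (h1 : θ < 1) :
    (m + k) * (1 - B) * ((θ - likelihoodMode B m k) ^ 2 * likelihood B m k θ) ≤
      -((θ - likelihoodMode B m k) * likelihoodDeriv B m k θ) := by
  have hn' : (0 : ℝ) < m + k := by exact_mod_cast hn
  have hA : 0 < (1 - B) * θ := mul_pos (by linarith) h0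
  have hA1 : (1 - B) * θ ≤ 1 - B := mul_le_of_le_one_right (by linarith) h1.le
  have hq0 : 0 < ((1 - B) * θ + B) * (1 - θ) := mul_pos (by linarith) (by linarith)
  have hq1 : ((1 - B) * θ + B) * (1 - θ) ≤ 1 := mul_le_one₀ (by linarith) (by linarith) (by linarith)
  have hg := likelihood_nonneg m k hB hB'.le h0.le h1.le
  have hnA : 0 < (m + k) * (1 - B) := mul_pos hn' (by linarith)
  have key : (m + k) * (1 - B) * (θ - likelihoodMode B m k) ^ 2 ≤
      (θ - likelihoodMode B m k) * ((m + k) * ((1 - B) * θ + B) - k) := by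
    unfold likelihoodMode
    rcases le_total 0 ((k - (m + k) * B) / ((m + k) * (1 - B))) with h | h
    · rw [max_eq_right h]
      apply le_of_eq
      generalize hr : (k - (m + k) * B) / ((m + k) * (1 - B)) = r
      have : r * ((m + k) * (1 - B)) = k - (m + k) * B := by
        rw [← hr, div_mul_cancel₀ _ hnA.ne']
      linear_combination (-(θ - r)) * this
    · rw [max_eq_left h]
      have : (k - (m + k) * B) ≤ 0 := by
        by_contra hc
        exact absurd h (not_le.mpr (div_pos (not_le.mp hc) hnA))
      nlinarith [mul_nonneg h0.le (neg_nonneg.mpr this)]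
  have h2 : (m + k) * (1 - B) * ((θ - likelihoodMode B m k) ^ 2 * likelihood B m k θ) ≤
      -((θ - likelihoodMode B m k) * likelihoodDeriv B m k θ) * (((1 - B) * θ + B) * (1 - θ)) := by
    have := mul_le_mul_of_nonneg_right key hg
    have e := likelihoodDeriv_mul B m k θ
    calc _ = (m + k) * (1 - B) * (θ - likelihoodMode B m k) ^ 2 * likelihood B m k θ := by ring
      _ ≤ _ := this
      _ = _ := by linear_combination (θ - likelihoodMode B m k) * e
  have h3 : 0 ≤ -((θ - likelihoodMode B m k) * likelihoodDeriv B m k θ) := by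
    by_contra hc
    have : 0 ≤ (m + k) * (1 - B) * ((θ - likelihoodMode B m k) ^ 2 * likelihood B m k θ) := by
      positivity
    nlinarith [mul_neg_of_neg_of_pos (not_le.mp hc) hq0]
  exact h2.trans (mul_le_of_le_one_right h3 hq1)

/-- Integrate the derivative of `(θ - θ*) g(θ)` over `[0, 1]`. As `θ*` lies in `[0, 1]`, the
boundary terms are nonnegative, hence `-∫ (θ - θ*) g' ≤ ∫ g`; the left side dominates the second
moment pointwise. -/
theorem integral_sq_sub_mode_mul_likelihood_le {B : ℝ} {m k : ℕ} (hB : 0 ≤ B) (hB' : B < 1)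
    (hn : 0 < m + k) :
    (m + k) * (1 - B) * ∫ θ in (0 : ℝ)..1, (θ - likelihoodMode B m k) ^ 2 * likelihood B m k θ ≤
      ∫ θ in (0 : ℝ)..1, likelihood B m k θ := by
  have cl := continuous_likelihood B m k
  have cd := continuous_likelihoodDeriv B m k
  have hfun : ∫ θ in (0 : ℝ)..1, (1 * likelihood B m k θ +
      (θ - likelihoodMode B m k) * likelihoodDeriv B m k θ) =
      (1 - likelihoodMode B m k) * likelihood B m k 1 -
        (0 - likelihoodMode B m k) * likelihood B m k 0 := by
    refine intervalIntegral.integral_eq_sub_of_hasDerivAt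
      (f := fun θ => (θ - likelihoodMode B m k) * likelihood B m k θ) (fun θ _ => ?_) ?_
    · exact ((hasDerivAt_id θ).sub_const _).mul (hasDerivAt_likelihood B m k θ)
    · exact Continuous.intervalIntegrable (by fun_prop) _ _
  rw [intervalIntegral.integral_add (Continuous.intervalIntegrable (by fun_prop) _ _)
    (Continuous.intervalIntegrable (by fun_prop) _ _)] at hfun
  simp only [one_mul] at hfun
  have h1 := mul_nonneg (sub_nonneg.mpr (likelihoodMode_le_one hB' hn))
    (likelihood_nonneg m k hB hB'.le zero_le_one le_rfl)
  have h0 := mul_nonneg (likelihoodMode_nonneg B m k)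
    (likelihood_nonneg m k hB hB'.le le_rfl zero_le_one)
  have hle : ∫ θ in (0 : ℝ)..1,
        (m + k) * (1 - B) * ((θ - likelihoodMode B m k) ^ 2 * likelihood B m k θ) ≤
      ∫ θ in (0 : ℝ)..1, -((θ - likelihoodMode B m k) * likelihoodDeriv B m k θ) := by
    refine intervalIntegral.integral_mono_on_of_le_Ioo zero_le_one
      (Continuous.intervalIntegrable (by fun_prop) _ _)
      (Continuous.intervalIntegrable (by fun_prop) _ _) fun θ hθ => ?_
    exact sq_mul_likelihood_le hB hB' hn hθ.1 hθ.2
  rw [intervalIntegral.integral_const_mul, intervalIntegral.integral_neg] at hle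
  linarith

theorem integral_sq_sub_mul_likelihood_le {B q : ℝ} {m k : ℕ} (hB : 0 ≤ B) (hB' : B < 1)
    (hn : 0 < m + k) (hq : 0 ≤ q) :
    ∫ θ in (0 : ℝ)..1, (θ - q) ^ 2 * likelihood B m k θ ≤
      (2 / ((m + k) * (1 - B)) +
        2 * ((k - (m + k) * ((1 - B) * q + B)) / ((m + k) * (1 - B))) ^ 2) *
        ∫ θ in (0 : ℝ)..1, likelihood B m k θ := by
  have cl := continuous_likelihood B m k
  have hnA : (0 : ℝ) < (m + k) * (1 - B) := mul_pos (by exact_mod_cast hn) (by linarith)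
  have hmode := integral_sq_sub_mode_mul_likelihood_le hB hB' hn
  have hI : 0 ≤ ∫ θ in (0 : ℝ)..1, likelihood B m k θ :=
    intervalIntegral.integral_nonneg zero_le_one fun θ hθ =>
      likelihood_nonneg m k hB hB'.le hθ.1 hθ.2
  have hdist : (likelihoodMode B m k - q) ^ 2 ≤
      ((k - (m + k) * ((1 - B) * q + B)) / ((m + k) * (1 - B))) ^ 2 := by
    have : (k - (m + k) * ((1 - B) * q + B)) / ((m + k) * (1 - B)) =
        (k - (m + k) * B) / ((m + k) * (1 - B)) - q := by
      rw [eq_sub_iff_add_eq, ← eq_sub_iff_add_eq', ← sub_div, eq_div_iff hnA.ne']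
      ring
    rw [this]
    exact sq_le_sq.mpr (abs_likelihoodMode_sub_le hq)
  have hle : ∫ θ in (0 : ℝ)..1, (θ - q) ^ 2 * likelihood B m k θ ≤
      ∫ θ in (0 : ℝ)..1, (2 * ((θ - likelihoodMode B m k) ^ 2 * likelihood B m k θ) +
        2 * (likelihoodMode B m k - q) ^ 2 * likelihood B m k θ) := by
    refine intervalIntegral.integral_mono_on zero_le_one
      (Continuous.intervalIntegrable (by fun_prop) _ _)
      (Continuous.intervalIntegrable (by fun_prop) _ _) fun θ hθ => ?_
    have := likelihood_nonneg m k hB hB'.le hθ.1 hθ.2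
    have h2 : (θ - q) ^ 2 ≤ 2 * (θ - likelihoodMode B m k) ^ 2 +
        2 * (likelihoodMode B m k - q) ^ 2 := by
      nlinarith [sq_nonneg ((θ - likelihoodMode B m k) - (likelihoodMode B m k - q))]
    nlinarith [mul_le_mul_of_nonneg_right h2 this]
  rw [intervalIntegral.integral_add (Continuous.intervalIntegrable (by fun_prop) _ _)
    (Continuous.intervalIntegrable (by fun_prop) _ _), intervalIntegral.integral_const_mul,
    intervalIntegral.integral_const_mul] at hle
  have h1 : ∫ θ in (0 : ℝ)..1, (θ - likelihoodMode B m k) ^ 2 * likelihood B m k θ ≤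
      1 / ((m + k) * (1 - B)) * ∫ θ in (0 : ℝ)..1, likelihood B m k θ := by
    rw [one_div, ← div_eq_inv_mul, le_div_iff₀ hnA, mul_comm]; exact hmode
  have h2 := mul_le_mul_of_nonneg_right hdist hI
  have e : 2 / ((m + k : ℝ) * (1 - B)) = 2 * (1 / ((m + k) * (1 - B))) := by ring
  rw [e]
  nlinarith

/-! ### The posterior mixture for the uniform prior -/

theorem simpleWeight_nonneg {B : ℝ} {n k i : ℕ} (hB : 0 ≤ B) (hi : i ≤ n) :
    0 ≤ simpleWeight 1 1 B n k i := by
  have : (i : ℝ) ≤ n := by exact_mod_cast hi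
  have h1 := Real.Gamma_pos_of_pos (show (0 : ℝ) < 1 + i by positivity)
  have h2 := Real.Gamma_pos_of_pos (show (0 : ℝ) < 1 + n - i by linarith)
  unfold simpleWeight
  positivity

theorem sum_simpleWeight_pos {B : ℝ} {n k : ℕ} (hB : 0 ≤ B) (hk : k ≤ n) :
    0 < ∑ j ∈ Finset.range (k + 1), simpleWeight 1 1 B n k j := by
  refine Finset.sum_pos' (fun i hi => simpleWeight_nonneg hB ?_) ⟨k, by simp, ?_⟩
  · exact (Nat.lt_succ_iff.mp (Finset.mem_range.mp hi)).trans hk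
  · have : (k : ℝ) ≤ n := by exact_mod_cast hk
    have h1 := Real.Gamma_pos_of_pos (show (0 : ℝ) < 1 + k by positivity)
    have h2 := Real.Gamma_pos_of_pos (show (0 : ℝ) < 1 + n - k by linarith)
    simp only [simpleWeight, Nat.choose_self, Nat.sub_self, pow_zero, Nat.cast_one]
    positivity

theorem simpleCoeff_nonneg {B : ℝ} {n k i : ℕ} (hB : 0 ≤ B) (hk : k ≤ n) (hi : i ≤ n) :
    0 ≤ simpleCoeff 1 1 B n k i :=
  div_nonneg (simpleWeight_nonneg hB hi) (sum_simpleWeight_pos hB hk).le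

theorem sum_simpleCoeff {B : ℝ} {n k : ℕ} (hB : 0 ≤ B) (hk : k ≤ n) :
    ∑ i ∈ Finset.range (n + 1), simpleCoeff 1 1 B n k i = 1 := by
  have h : ∑ i ∈ Finset.range (n + 1), simpleWeight 1 1 B n k i =
      ∑ i ∈ Finset.range (k + 1), simpleWeight 1 1 B n k i := by
    refine (Finset.sum_subset (fun i hi => ?_) fun i _ hi => ?_).symm
    · simp only [Finset.mem_range] at hi ⊢; omega
    · simp only [Finset.mem_range, not_lt] at hi
      simp [simpleWeight, Nat.choose_eq_zero_of_lt (show k < i by omega)]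
  simp only [simpleCoeff]
  rw [← Finset.sum_div, h, div_self (sum_simpleWeight_pos hB hk).ne']

/-- The mixture of the beta distributions `Beta(1 + i, 1 + n - i)` with weights `C i`. -/
noncomputable def betaMixture (n : ℕ) (C : ℕ → ℝ) : Measure ℝ :=
  ∑ i ∈ Finset.range (n + 1), ENNReal.ofReal (C i) • betaMeasure (1 + i) (1 + n - i)

theorem lintegral_betaMixture (n : ℕ) (C : ℕ → ℝ) (hC : ∀ i ≤ n, 0 ≤ C i) {F : ℝ → ℝ}
    (hF : Measurable F) (hF0 : ∀ θ, 0 ≤ F θ) :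
    ∫⁻ θ, ENNReal.ofReal (F θ) ∂betaMixture n C =
      ∫⁻ θ, ENNReal.ofReal (∑ i ∈ Finset.range (n + 1),
        C i * betaPDFReal (1 + i) (1 + n - i) θ * F θ) := by
  have hpdf : ∀ i ≤ n, ∀ θ, 0 ≤ betaPDFReal (1 + i) (1 + n - i) θ := fun i hi θ => by
    have : (i : ℝ) ≤ n := by exact_mod_cast hi
    by_cases h : 0 < θ ∧ θ < 1
    · exact (betaPDFReal_pos h.1 h.2 (by positivity) (by linarith)).le
    · simp [betaPDFReal, h]
  have hle : ∀ i ∈ Finset.range (n + 1), i ≤ n := fun i hi => Nat.lt_succ_iff.mp (by simpa using hi)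
  unfold betaMixture
  rw [lintegral_finsetSum_measure]
  have : ∀ θ, ENNReal.ofReal (∑ i ∈ Finset.range (n + 1),
      C i * betaPDFReal (1 + i) (1 + n - i) θ * F θ) = ∑ i ∈ Finset.range (n + 1),
      ENNReal.ofReal (C i) * (betaPDF (1 + i) (1 + n - i) θ * ENNReal.ofReal (F θ)) := fun θ => by
    rw [ENNReal.ofReal_sum_of_nonneg fun i hi => mul_nonneg (mul_nonneg (hC i (hle i hi))
      (hpdf i (hle i hi) θ)) (hF0 θ)]
    refine Finset.sum_congr rfl fun i hi => ?_
    rw [mul_assoc, ENNReal.ofReal_mul (hC i (hle i hi)), ENNReal.ofReal_mul (hpdf i (hle i hi) θ)]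
    rfl
  simp_rw [this]
  have hm : ∀ a b : ℝ, Measurable (betaPDF a b) := fun a b =>
    (measurable_betaPDFReal a b).ennreal_ofReal
  rw [lintegral_finsetSum]
  · refine Finset.sum_congr rfl fun i _ => ?_
    rw [lintegral_smul_measure, betaMeasure, lintegral_withDensity_eq_lintegral_mul _ (hm _ _)
      hF.ennreal_ofReal, smul_eq_mul, ← lintegral_const_mul _ ((hm _ _).mul hF.ennreal_ofReal)]
    rfl
  · intro i _
    exact ((hm _ _).mul hF.ennreal_ofReal).const_mul _

/-- The Gamma factors of the weights cancel those of the beta densities, leaving `(1 - θ)^(n-k)`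
times the binomial expansion of `(θ + B(1 - θ))^k`, and `θ + B(1 - θ) = (1 - B)θ + B`. -/
theorem sum_simpleCoeff_mul_betaPDFReal {B θ : ℝ} {n k : ℕ} (hk : k ≤ n) (h0 : 0 < θ)
    (h1 : θ < 1) :
    ∑ i ∈ Finset.range (n + 1), simpleCoeff 1 1 B n k i * betaPDFReal (1 + i) (1 + n - i) θ =
      Real.Gamma (n + 2) / (∑ j ∈ Finset.range (k + 1), simpleWeight 1 1 B n k j) *
        likelihood B (n - k) k θ := by
  have hterm : ∀ i ∈ Finset.range (k + 1),
      simpleCoeff 1 1 B n k i * betaPDFReal (1 + i) (1 + n - i) θ =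
      Real.Gamma (n + 2) / (∑ j ∈ Finset.range (k + 1), simpleWeight 1 1 B n k j) *
        (1 - θ) ^ (n - k) * (θ ^ i * (B * (1 - θ)) ^ (k - i) * k.choose i) := fun i hi => by
    have hik : i ≤ k := Nat.lt_succ_iff.mp (by simpa using hi)
    have hin : i ≤ n := hik.trans hk
    have : (i : ℝ) ≤ n := by exact_mod_cast hin
    have g1 := (Real.Gamma_pos_of_pos (show (0 : ℝ) < 1 + i by positivity)).ne'
    have g2 := (Real.Gamma_pos_of_pos (show (0 : ℝ) < 1 + n - i by linarith)).ne'
    rw [betaPDFReal, if_pos ⟨h0, h1⟩, beta, simpleCoeff, simpleWeight]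
    have e1 : θ ^ ((1 : ℝ) + i - 1) = θ ^ i := by
      rw [add_sub_cancel_left, Real.rpow_natCast]
    have e2 : (1 - θ) ^ ((1 : ℝ) + n - i - 1) = (1 - θ) ^ (n - k) * (1 - θ) ^ (k - i) := by
      rw [← pow_add, ← Real.rpow_natCast]
      congr 1
      rw [show n - k + (k - i) = n - i by omega, Nat.cast_sub hin]; ring
    have e3 : (1 : ℝ) + i + (1 + n - i) = n + 2 := by ring
    rw [e1, e2, e3, mul_pow]
    field_simp
  have hsub : ∑ i ∈ Finset.range (n + 1),
      simpleCoeff 1 1 B n k i * betaPDFReal (1 + i) (1 + n - i) θ =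
      ∑ i ∈ Finset.range (k + 1),
        simpleCoeff 1 1 B n k i * betaPDFReal (1 + i) (1 + n - i) θ := by
    refine (Finset.sum_subset (fun i hi => ?_) fun i _ hi => ?_).symm
    · simp only [Finset.mem_range] at hi ⊢; omega
    · simp only [Finset.mem_range, not_lt] at hi
      simp [simpleCoeff, simpleWeight, Nat.choose_eq_zero_of_lt (show k < i by omega)]
  rw [hsub, Finset.sum_congr rfl hterm, ← Finset.mul_sum, ← add_pow, likelihood]
  rw [show θ + B * (1 - θ) = (1 - B) * θ + B by ring]; ring

theorem lintegral_betaMixture_simpleCoeff {B : ℝ} {n k : ℕ} (hB : 0 ≤ B) (hB' : B ≤ 1)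
    (hk : k ≤ n) {F : ℝ → ℝ} (hF : Continuous F) (hF0 : ∀ θ, 0 ≤ F θ) :
    ∫⁻ θ, ENNReal.ofReal (F θ) ∂betaMixture n (simpleCoeff 1 1 B n k) =
      ENNReal.ofReal
        (Real.Gamma (n + 2) / (∑ j ∈ Finset.range (k + 1), simpleWeight 1 1 B n k j) *
          ∫ θ in (0 : ℝ)..1, F θ * likelihood B (n - k) k θ) := by
  have hc : 0 ≤ Real.Gamma (n + 2) / (∑ j ∈ Finset.range (k + 1), simpleWeight 1 1 B n k j) :=
    div_nonneg (Real.Gamma_pos_of_pos (by positivity)).le (sum_simpleWeight_pos hB hk).le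
  have cl := continuous_likelihood B (n - k) k
  rw [lintegral_betaMixture n _ (fun i hi => simpleCoeff_nonneg hB hk hi) hF.measurable hF0]
  rw [← intervalIntegral.integral_const_mul, intervalIntegral.integral_of_le zero_le_one,
    integral_Ioc_eq_integral_Ioo, ofReal_integral_eq_lintegral_ofReal, ← lintegral_indicator
    measurableSet_Ioo]
  · refine lintegral_congr fun θ => ?_
    by_cases h : θ ∈ Set.Ioo (0 : ℝ) 1
    · rw [Set.indicator_of_mem h, ← Finset.sum_mul, sum_simpleCoeff_mul_betaPDFReal hk h.1 h.2]
      congr 1; ring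
    · rw [Set.indicator_of_notMem h]
      have : ∀ a b : ℝ, betaPDFReal a b θ = 0 := fun a b => if_neg h
      simp [this]
  · have : Continuous fun θ => Real.Gamma (n + 2) /
        (∑ j ∈ Finset.range (k + 1), simpleWeight 1 1 B n k j) *
        (F θ * likelihood B (n - k) k θ) := by fun_prop
    exact (this.integrableOn_Icc).mono_set Set.Ioo_subset_Icc_self
  · refine ae_restrict_of_forall_mem measurableSet_Ioo fun θ hθ => ?_
    exact mul_nonneg hc (mul_nonneg (hF0 θ) (likelihood_nonneg _ _ hB hB' hθ.1.le hθ.2.le))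

theorem betaMixture_univ {n : ℕ} {C : ℕ → ℝ} (hC : ∀ i ≤ n, 0 ≤ C i)
    (hsum : ∑ i ∈ Finset.range (n + 1), C i = 1) : betaMixture n C Set.univ = 1 := by
  have hle : ∀ i ∈ Finset.range (n + 1), i ≤ n := fun i hi => Nat.lt_succ_iff.mp (by simpa using hi)
  rw [betaMixture, Measure.finsetSum_apply]
  refine Eq.trans ?_ ((congrArg ENNReal.ofReal hsum).trans ENNReal.ofReal_one)
  rw [ENNReal.ofReal_sum_of_nonneg fun i hi => hC i (hle i hi)]
  refine Finset.sum_congr rfl fun i hi => ?_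
  have : (i : ℝ) ≤ n := by exact_mod_cast hle i hi
  have := isProbabilityMeasureBeta (show (0 : ℝ) < 1 + i by positivity)
    (show (0 : ℝ) < 1 + n - i by linarith)
  simp

/-- The mixture has total mass one; testing it against the constant `1` identifies the normalising
constant without evaluating the integral. -/
theorem normalization_mul_integral_likelihood {B : ℝ} {n k : ℕ} (hB : 0 ≤ B) (hB' : B ≤ 1)
    (hk : k ≤ n) :
    Real.Gamma (n + 2) / (∑ j ∈ Finset.range (k + 1), simpleWeight 1 1 B n k j) *
      ∫ θ in (0 : ℝ)..1, likelihood B (n - k) k θ = 1 := by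
  have h := lintegral_betaMixture_simpleCoeff hB hB' hk (F := fun _ => 1) continuous_const
    fun _ => zero_le_one
  simp only [ENNReal.ofReal_one, lintegral_const, one_mul] at h
  rw [betaMixture_univ (fun i hi => simpleCoeff_nonneg hB hk hi) (sum_simpleCoeff hB hk)] at h
  exact (ENNReal.ofReal_eq_one.mp h.symm)

theorem lintegral_sq_sub_betaMixture_le {B q : ℝ} {n k : ℕ} (hB : 0 ≤ B) (hB' : B < 1)
    (hn : 0 < n) (hk : k ≤ n) (hq : 0 ≤ q) :
    ∫⁻ θ, ENNReal.ofReal ((θ - q) ^ 2) ∂betaMixture n (simpleCoeff 1 1 B n k) ≤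
      ENNReal.ofReal (2 / (n * (1 - B)) +
        2 * ((k - n * ((1 - B) * q + B)) / (n * (1 - B))) ^ 2) := by
  rw [lintegral_betaMixture_simpleCoeff hB hB'.le hk (by fun_prop) fun θ => sq_nonneg _]
  refine ENNReal.ofReal_le_ofReal ?_
  have hc : 0 ≤ Real.Gamma (n + 2) / (∑ j ∈ Finset.range (k + 1), simpleWeight 1 1 B n k j) :=
    div_nonneg (Real.Gamma_pos_of_pos (by positivity)).le (sum_simpleWeight_pos hB hk).le
  have h := integral_sq_sub_mul_likelihood_le (m := n - k) (k := k) (q := q) hB hB' (by omega) hq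
  have e : (((n - k : ℕ) : ℝ) + k) = n := by rw [Nat.cast_sub hk]; ring
  rw [e] at h
  refine (mul_le_mul_of_nonneg_left h hc).trans_eq ?_
  rw [mul_left_comm, normalization_mul_integral_likelihood hB hB'.le hk, mul_one]

theorem lintegral_sq_sub_betaMixture_le_one {q : ℝ} {n : ℕ} {C : ℕ → ℝ} (hC : ∀ i ≤ n, 0 ≤ C i)
    (hsum : ∑ i ∈ Finset.range (n + 1), C i = 1) (hq : 0 ≤ q) (hq' : q ≤ 1) :
    ∫⁻ θ, ENNReal.ofReal ((θ - q) ^ 2) ∂betaMixture n C ≤ 1 := by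
  rw [← betaMixture_univ hC hsum]
  have h1 : betaMixture n C Set.univ = ∫⁻ θ, ENNReal.ofReal ((fun _ => (1 : ℝ)) θ) ∂betaMixture n C := by
    simp
  rw [h1, lintegral_betaMixture n C hC (by fun_prop) fun _ => sq_nonneg _,
    lintegral_betaMixture n C hC (by fun_prop) fun _ => zero_le_one]
  refine lintegral_mono fun θ => ENNReal.ofReal_le_ofReal (Finset.sum_le_sum fun i hi => ?_)
  have hi' : i ≤ n := Nat.lt_succ_iff.mp (by simpa using hi)
  have : (i : ℝ) ≤ n := by exact_mod_cast hi'
  by_cases h : 0 < θ ∧ θ < 1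
  · refine mul_le_mul_of_nonneg_left ?_ (mul_nonneg (hC i hi')
      (betaPDFReal_pos h.1 h.2 (by positivity) (by linarith)).le)
    rw [sq_le_one_iff_abs_le_one, abs_le]
    constructor <;> linarith [h.1, h.2]
  · simp [betaPDFReal, h]

/-! ### The error of the posterior in terms of the experiments -/

section PosteriorError

variable {d t : ℕ} (N : Seminorm ℝ (Fin d → ℝ)) (Δ : ℝ) (S : Fin t → Experiment d) (x : Fin d → ℝ)

theorem successCount_le_neighborCount : successCount N Δ S x ≤ neighborCount N Δ S x :=
  Finset.card_le_card (Finset.filter_subset _ _)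

theorem meanA_add_meanB (hA : ∀ i, (S i).A = 1 - (S i).B) (hn : 0 < neighborCount N Δ S x) :
    meanA N Δ S x + meanB N Δ S x = 1 := by
  have hn' : (neighborCount N Δ S x : ℝ) ≠ 0 := by exact_mod_cast hn.ne'
  rw [meanA, meanB, ← add_div, ← Finset.sum_add_distrib, div_eq_one_iff_eq hn']
  simp [hA, neighborCount]

theorem coeff_eq_simpleCoeff (hA : ∀ i, (S i).A = 1 - (S i).B)
    (hn : 0 < neighborCount N Δ S x) :
    coeff N Δ S x 1 1 =
      simpleCoeff 1 1 (meanB N Δ S x) (neighborCount N Δ S x) (successCount N Δ S x) :=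
  funext fun _ => if_pos (meanA_add_meanB N Δ S x hA hn)

/-- Without neighbours both means are `0 / 0 = 0`, so the test `meanA + meanB = 1` fails and the
general recursion on the empty list returns the prior. -/
theorem coeff_zero_of_neighborCount_eq_zero (hn : neighborCount N Δ S x = 0) :
    coeff N Δ S x 1 1 0 = 1 := by
  have h : neighbors N Δ S x = ∅ := Finset.card_eq_zero.mp hn
  simp [coeff, meanA, meanB, neighborOutcomes, h, bayesCoeff]

theorem meanB_nonneg (hB : ∀ i, 0 ≤ (S i).B) : 0 ≤ meanB N Δ S x :=
  div_nonneg (Finset.sum_nonneg fun i _ => hB i) (Nat.cast_nonneg _)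

theorem coeff_nonneg (hA : ∀ i, (S i).A = 1 - (S i).B) (hB : ∀ i, 0 ≤ (S i).B) :
    ∀ i ≤ neighborCount N Δ S x, 0 ≤ coeff N Δ S x 1 1 i := by
  intro i hi
  rcases Nat.eq_zero_or_pos (neighborCount N Δ S x) with h | h
  · rw [h, Nat.le_zero] at hi
    rw [hi, coeff_zero_of_neighborCount_eq_zero N Δ S x h]; exact zero_le_one
  · rw [coeff_eq_simpleCoeff N Δ S x hA h]
    exact simpleCoeff_nonneg (meanB_nonneg N Δ S x hB) (successCount_le_neighborCount N Δ S x) hi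

theorem sum_coeff (hA : ∀ i, (S i).A = 1 - (S i).B) (hB : ∀ i, 0 ≤ (S i).B) :
    ∑ i ∈ Finset.range (neighborCount N Δ S x + 1), coeff N Δ S x 1 1 i = 1 := by
  rcases Nat.eq_zero_or_pos (neighborCount N Δ S x) with h | h
  · rw [h]; simp [coeff_zero_of_neighborCount_eq_zero N Δ S x h]
  · rw [coeff_eq_simpleCoeff N Δ S x hA h]
    exact sum_simpleCoeff (meanB_nonneg N Δ S x hB) (successCount_le_neighborCount N Δ S x)

theorem posterior_eq_betaMixture :
    posterior N Δ S x (fun _ => 1) (fun _ => 1) =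
      betaMixture (neighborCount N Δ S x) (coeff N Δ S x 1 1) := rfl

theorem lintegral_sq_sub_posterior_le_one (hA : ∀ i, (S i).A = 1 - (S i).B)
    (hB : ∀ i, 0 ≤ (S i).B) {q : ℝ} (hq : 0 ≤ q) (hq' : q ≤ 1) :
    ∫⁻ θ, ENNReal.ofReal ((θ - q) ^ 2) ∂posterior N Δ S x (fun _ => 1) (fun _ => 1) ≤ 1 := by
  rw [posterior_eq_betaMixture]
  exact lintegral_sq_sub_betaMixture_le_one (coeff_nonneg N Δ S x hA hB)
    (sum_coeff N Δ S x hA hB) hq hq'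

/-- The mixture bound involves the averaged parameter only through `n(1 - B)` and `nB`, which are
sums over the individual neighbours. -/
theorem lintegral_sq_sub_posterior_le (hA : ∀ i, (S i).A = 1 - (S i).B)
    (hB : ∀ i, 0 ≤ (S i).B) {q : ℝ} (hq : 0 ≤ q)
    (hW : 0 < ∑ i ∈ neighbors N Δ S x, (1 - (S i).B)) :
    ∫⁻ θ, ENNReal.ofReal ((θ - q) ^ 2) ∂posterior N Δ S x (fun _ => 1) (fun _ => 1) ≤
      ENNReal.ofReal (2 / (∑ i ∈ neighbors N Δ S x, (1 - (S i).B)) +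
        2 * ((∑ i ∈ neighbors N Δ S x,
          ((if (S i).outcome = true then 1 else 0) - ((1 - (S i).B) * q + (S i).B))) /
          ∑ i ∈ neighbors N Δ S x, (1 - (S i).B)) ^ 2) := by
  have hn : 0 < neighborCount N Δ S x := by
    rw [neighborCount, Finset.card_pos]
    exact Finset.nonempty_of_sum_ne_zero hW.ne'
  have hn' : (neighborCount N Δ S x : ℝ) ≠ 0 := by exact_mod_cast hn.ne'
  have hB1 : neighborCount N Δ S x * meanB N Δ S x = ∑ i ∈ neighbors N Δ S x, (S i).B := by
    rw [meanB, mul_div_cancel₀ _ hn']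
  have hsum : ∑ i ∈ neighbors N Δ S x, (1 - (S i).B) =
      neighborCount N Δ S x * (1 - meanB N Δ S x) := by
    rw [mul_sub, hB1, Finset.sum_sub_distrib]; simp [neighborCount]
  have hk : (successCount N Δ S x : ℝ) =
      ∑ i ∈ neighbors N Δ S x, (if (S i).outcome = true then (1 : ℝ) else 0) := by
    rw [successCount, Finset.card_filter]; push_cast; rfl
  have hnum : ∑ i ∈ neighbors N Δ S x,
      ((if (S i).outcome = true then (1 : ℝ) else 0) - ((1 - (S i).B) * q + (S i).B)) =
      successCount N Δ S x -
        neighborCount N Δ S x * ((1 - meanB N Δ S x) * q + meanB N Δ S x) := by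
    rw [Finset.sum_sub_distrib, ← hk, Finset.sum_add_distrib, ← Finset.sum_mul, hsum, ← hB1]
    ring
  -- Positivity of the total weight excludes the degenerate case in which no neighbour carries
  -- information on `θ`.
  have hB' : meanB N Δ S x < 1 := by
    rw [hsum] at hW
    have := pos_of_mul_pos_right hW (Nat.cast_nonneg _)
    linarith
  rw [posterior_eq_betaMixture, coeff_eq_simpleCoeff N Δ S x hA hn, hnum, hsum]
  exact lintegral_sq_sub_betaMixture_le (meanB_nonneg N Δ S x hB) hB' hn
    (successCount_le_neighborCount N Δ S x) hq

end PosteriorError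

/-! ### The volume of balls in the cube -/

/-- Expand in the standard basis. Asking for `1 ≤ M` makes `Δ / M ≤ 1` whenever `Δ ≤ 1`. -/
theorem exists_seminorm_le_mul_norm {d : ℕ} (N : Seminorm ℝ (Fin d → ℝ)) :
    ∃ M : ℝ, 1 ≤ M ∧ ∀ v, N v ≤ M * ‖v‖ := by
  have hs : 0 ≤ ∑ j, N (Pi.single j 1) := Finset.sum_nonneg fun j _ => apply_nonneg N _
  refine ⟨1 + ∑ j, N (Pi.single j 1), by linarith, fun v => ?_⟩
  have h1 : N v ≤ ∑ j, N (v j • Pi.single j (1 : ℝ)) := by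
    conv_lhs => rw [pi_eq_sum_univ' v]
    refine (Finset.le_sum_of_subadditive N (map_zero N).le (map_add_le_add N) _ _).trans_eq ?_
    refine Finset.sum_congr rfl fun j _ => ?_
    congr 2
  refine h1.trans ?_
  have h2 : ∑ j, N (v j • Pi.single j (1 : ℝ)) ≤ ∑ j, ‖v‖ * N (Pi.single j 1) := by
    refine Finset.sum_le_sum fun j _ => ?_
    rw [map_smul_eq_mul]
    exact mul_le_mul_of_nonneg_right (norm_le_pi_norm v j) (apply_nonneg N _)
  rw [← Finset.mul_sum] at h2
  nlinarith [norm_nonneg v]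

theorem continuous_seminorm {d : ℕ} (N : Seminorm ℝ (Fin d → ℝ)) : Continuous N := by
  obtain ⟨M, hM, h⟩ := exists_seminorm_le_mul_norm N
  have : LipschitzWith ⟨M, by linarith⟩ N := LipschitzWith.of_dist_le_mul fun u v => by
    rw [dist_eq_norm, dist_eq_norm, Real.norm_eq_abs]
    exact (abs_sub_map_le_sub N u v).trans (h _)
  exact this.continuous

theorem measurableSet_seminorm_ball {d : ℕ} (N : Seminorm ℝ (Fin d → ℝ)) (x : Fin d → ℝ) (Δ : ℝ) :
    MeasurableSet {y | N (x - y) ≤ Δ} := by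
  have := continuous_seminorm N
  exact (isClosed_le (by fun_prop) continuous_const).measurableSet

/-- Shrinking the unit cube towards `x` by the factor `δ = Δ / M` gives a box of side `δ` that stays
in the cube even when `x` is on its boundary, and whose points are within `δ` of `x` in the sup
norm. -/
theorem ofReal_pow_le_volume_ball {d : ℕ} (N : Seminorm ℝ (Fin d → ℝ)) {M Δ : ℝ} (hM : 1 ≤ M)
    (hN : ∀ v, N v ≤ M * ‖v‖) {x : Fin d → ℝ} (hx : x ∈ Set.Icc (0 : Fin d → ℝ) 1)
    (hΔ : 0 < Δ) (hΔ' : Δ ≤ 1) :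
    ENNReal.ofReal ((Δ / M) ^ d) ≤
      volume.restrict (Set.Icc (0 : Fin d → ℝ) 1) {y | N (x - y) ≤ Δ} := by
  have hM0 : 0 < M := by linarith
  set δ := Δ / M with hδ
  have hδ0 : 0 < δ := div_pos hΔ hM0
  have hδ1 : δ ≤ 1 := (div_le_one hM0).mpr (hΔ'.trans hM)
  rw [Measure.restrict_apply (measurableSet_seminorm_ball N x Δ)]
  have hvol : volume (Set.Icc (fun j => (1 - δ) * x j) fun j => (1 - δ) * x j + δ) =
      ENNReal.ofReal (δ ^ d) := by
    rw [Real.volume_Icc_pi]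
    simp [ENNReal.ofReal_pow hδ0.le]
  rw [← hvol]
  refine measure_mono fun y hy => ?_
  have hj : ∀ j, 0 ≤ y j ∧ y j ≤ 1 ∧ |x j - y j| ≤ δ := fun j => by
    have h1 := hy.1 j
    have h2 := hy.2 j
    have h3 := hx.1 j
    have h4 := hx.2 j
    simp only [Pi.zero_apply, Pi.one_apply] at h1 h2 h3 h4
    have h5 : δ * x j ≤ δ := mul_le_of_le_one_right hδ0.le h4
    have h6 : 0 ≤ δ * x j := mul_nonneg hδ0.le h3
    have h7 : 0 ≤ (1 - δ) * x j := mul_nonneg (by linarith) h3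
    have h8 : (1 - δ) * x j ≤ 1 - δ := mul_le_of_le_one_right (by linarith) h4
    refine ⟨by linarith, by linarith, abs_le.mpr ⟨by linarith, by linarith⟩⟩
  refine ⟨(hN _).trans ?_, fun j => (hj j).1, fun j => (hj j).2.1⟩
  have : ‖x - y‖ ≤ δ := (pi_norm_le_iff_of_nonneg hδ0.le).mpr fun j => by
    simpa using (hj j).2.2
  calc M * ‖x - y‖ ≤ M * δ := mul_le_mul_of_nonneg_left this hM0.le
    _ = Δ := by rw [hδ]; field_simp

/-! ### Moments in the noisy model -/

/-- An outcome as a real number. -/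
def outcomeValue (b : Bool) : ℝ := if b = true then 1 else 0

theorem measurable_outcomeValue : Measurable outcomeValue := measurable_from_top

theorem outcomeValue_mem (b : Bool) : 0 ≤ outcomeValue b ∧ outcomeValue b ≤ 1 := by
  unfold outcomeValue; split_ifs <;> norm_num

theorem integrable_of_measurable_of_bounded {Ω : Type*} [MeasurableSpace Ω] {P : Measure Ω}
    [IsFiniteMeasure P] {f : Ω → ℝ} (hf : Measurable f) (C : ℝ) (hC : ∀ ω, |f ω| ≤ C) :
    Integrable f P :=
  Integrable.of_bound hf.aestronglyMeasurable C (Filter.Eventually.of_forall hC)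

theorem integral_mul_eq_integral_mul_condExp {Ω : Type*} {m m0 : MeasurableSpace Ω}
    {P : Measure Ω} [IsFiniteMeasure P] (hle : m ≤ m0) {f g : Ω → ℝ} (hf : Measurable[m] f)
    (hg : Integrable g P) {C : ℝ} (hC : ∀ ω, |f ω| ≤ C) :
    ∫ ω, f ω * g ω ∂P = ∫ ω, f ω * (P[g | m]) ω ∂P := by
  have h := condExp_stronglyMeasurable_mul_of_bound hle hf.stronglyMeasurable hg C
    (Filter.Eventually.of_forall hC)
  exact (integral_condExp hle (f := f * g)).symm.trans (integral_congr_ae h)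

/-- The indicator of the ball of radius `Δ` about `x`. -/
noncomputable def kernel {d : ℕ} (N : Seminorm ℝ (Fin d → ℝ)) (Δ : ℝ)
    (x y : Fin d → ℝ) : ℝ :=
  Set.indicator {y | N (x - y) ≤ Δ} (fun _ => 1) y

theorem measurable_kernel {d : ℕ} (N : Seminorm ℝ (Fin d → ℝ)) (Δ : ℝ)
    (x : Fin d → ℝ) : Measurable (kernel N Δ x) :=
  measurable_const.indicator (measurableSet_seminorm_ball N x Δ)

theorem kernel_eq_zero_or_one {d : ℕ} (N : Seminorm ℝ (Fin d → ℝ)) (Δ : ℝ)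
    (x y : Fin d → ℝ) : kernel N Δ x y = 0 ∨ kernel N Δ x y = 1 := by
  unfold kernel
  by_cases h : y ∈ {y | N (x - y) ≤ Δ}
  · exact Or.inr (Set.indicator_of_mem h _)
  · exact Or.inl (Set.indicator_of_notMem h _)

/-- The probability that a uniform point lies in the ball of radius `Δ` about `x`. -/
noncomputable def ballMass {d : ℕ} (N : Seminorm ℝ (Fin d → ℝ)) (Δ : ℝ)
    (x : Fin d → ℝ) : ℝ :=
  (volume.restrict (Set.Icc (0 : Fin d → ℝ) 1)).real {y | N (x - y) ≤ Δ}

theorem abs_kernel_le {d : ℕ} (N : Seminorm ℝ (Fin d → ℝ)) (Δ : ℝ)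
    (x y : Fin d → ℝ) : |kernel N Δ x y| ≤ 1 := by
  rcases kernel_eq_zero_or_one N Δ x y with h | h <;> simp [h]

/-- The centred contribution of an experiment with point `y` and outcome `b` to the success count
of the ball of radius `Δ` about `x`. -/
noncomputable def residual {d : ℕ} (N : Seminorm ℝ (Fin d → ℝ)) (Δ : ℝ)
    (x : Fin d → ℝ) (π : (Fin d → ℝ) → ℝ) (β : ℝ) (y : Fin d → ℝ) (b : Bool) : ℝ :=
  kernel N Δ x y * (outcomeValue b - ((1 - β) * π y + β))

theorem success_prob_mem {β p : ℝ} (hβ : 0 ≤ β ∧ β ≤ 1) (hp : 0 ≤ p ∧ p ≤ 1) :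
    0 ≤ (1 - β) * p + β ∧ (1 - β) * p + β ≤ 1 := by
  have h1 : 0 ≤ (1 - β) * p := mul_nonneg (by linarith) hp.1
  have h2 : (1 - β) * p ≤ 1 - β := mul_le_of_le_one_right (by linarith) hp.2
  constructor <;> linarith

theorem abs_residual_le {d : ℕ} (N : Seminorm ℝ (Fin d → ℝ)) (Δ : ℝ) (x : Fin d → ℝ)
    {π : (Fin d → ℝ) → ℝ} {β : ℝ} (hπ01 : ∀ y, 0 ≤ π y ∧ π y ≤ 1) (hβ : 0 ≤ β ∧ β ≤ 1)
    (y : Fin d → ℝ) (b : Bool) : |residual N Δ x π β y b| ≤ 1 := by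
  have h1 := success_prob_mem hβ (hπ01 y)
  have h2 := outcomeValue_mem b
  rw [residual, abs_mul]
  exact mul_le_one₀ (abs_kernel_le N Δ x y) (abs_nonneg _)
    (abs_le.mpr ⟨by linarith, by linarith⟩)

namespace NoisyModel

variable {d t : ℕ} {Ω : Type*} [MeasurableSpace Ω] {P : Measure Ω}
  {π : (Fin d → ℝ) → ℝ} {B : Fin t → ℝ} {σ : ℝ} {X : Fin t → Ω → Fin d → ℝ} {ε : Fin t → Ω → ℝ}
  {s : Fin t → Ω → Bool}

theorem ae_mem_cube (hm : NoisyModel P π B σ X ε s) (i : Fin t) :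
    ∀ᵐ ω ∂P, X i ω ∈ Set.Icc (0 : Fin d → ℝ) 1 := by
  have h : ∀ᵐ y ∂(P.map (X i)), y ∈ Set.Icc (0 : Fin d → ℝ) 1 := by
    rw [hm.uniform i]
    exact ae_restrict_mem measurableSet_Icc
  exact ae_of_ae_map (hm.measurable_point i).aemeasurable h

/-- The noise disappears from first moments: the conditional success probability is `(1 - B i) π(X)
+ B i` plus `(1 - π(X)) ε`, and the second term, multiplied by any bounded function of the point,
has mean zero by independence. -/
theorem integral_mul_outcome [IsProbabilityMeasure P] (hm : NoisyModel P π B σ X ε s) (hπ : Measurable π)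
    (hπ01 : ∀ y, 0 ≤ π y ∧ π y ≤ 1) {h : (Fin d → ℝ) → ℝ} (hh : Measurable h) {C : ℝ}
    (hC : ∀ y, |h y| ≤ C) (i : Fin t) :
    ∫ ω, h (X i ω) * outcomeValue (s i ω) ∂P =
      ∫ ω, h (X i ω) * ((1 - B i) * π (X i ω) + B i) ∂P := by
  have hX := hm.measurable_point i
  have hε := hm.measurable_noise i
  have hs := hm.measurable_outcome i
  have hle : MeasurableSpace.comap (fun ω => (X i ω, ε i ω)) inferInstance ≤ ‹MeasurableSpace Ω› :=
    (hX.prodMk hε).comap_le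
  -- Conditional probability unfolds to the conditional expectation of this indicator.
  have hind : (s i ⁻¹' {true}).indicator (fun _ => (1 : ℝ)) = fun ω => outcomeValue (s i ω) := by
    ext ω
    cases hω : s i ω <;> simp [Set.indicator, outcomeValue, hω]
  have hXm : Measurable[MeasurableSpace.comap (fun ω => (X i ω, ε i ω)) inferInstance]
      fun ω => h (X i ω) :=
    (hh.comp measurable_fst).comp (comap_measurable fun ω => (X i ω, ε i ω))
  have hout : Integrable (fun ω => outcomeValue (s i ω)) P :=
    integrable_of_measurable_of_bounded (measurable_outcomeValue.comp hs) 1 fun ω => by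
      rw [abs_of_nonneg (outcomeValue_mem _).1]; exact (outcomeValue_mem _).2
  have hb := hm.bernoulli i
  rw [hind] at hb
  have hεi : Integrable (ε i) P := (hm.memLp_noise i).integrable (by norm_num)
  have hmeas1 : Measurable fun ω => h (X i ω) * (1 - π (X i ω)) :=
    (hh.comp hX).mul (measurable_const.sub (hπ.comp hX))
  have hC0 : 0 ≤ C := (abs_nonneg _).trans (hC 0)
  have hint1 : Integrable (fun ω => (h (X i ω) * (1 - π (X i ω))) * ε i ω) P := by
    refine hεi.bdd_mul (c := C) hmeas1.aestronglyMeasurable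
      (Filter.Eventually.of_forall fun ω => ?_)
    rw [Real.norm_eq_abs, abs_mul]
    have := hπ01 (X i ω)
    exact (mul_le_of_le_one_right (abs_nonneg _) (abs_le.mpr ⟨by linarith, by linarith⟩)).trans
      (hC _)
  have hint2 : Integrable (fun ω => h (X i ω) * ((1 - B i) * π (X i ω) + B i)) P := by
    refine integrable_of_measurable_of_bounded
      ((hh.comp hX).mul (((hπ.comp hX).const_mul _).add_const _)) (C * (|1 - B i| + |B i|))
      fun ω => ?_
    rw [abs_mul]
    refine mul_le_mul (hC _) ((abs_add_le _ _).trans (add_le_add ?_ le_rfl)) (abs_nonneg _) hC0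
    rw [abs_mul]
    have := hπ01 (X i ω)
    exact mul_le_of_le_one_right (abs_nonneg _) (abs_le.mpr ⟨by linarith, by linarith⟩)
  have hzero : ∫ ω, (h (X i ω) * (1 - π (X i ω))) * ε i ω ∂P = 0 := by
    have hi : IndepFun (fun ω => h (X i ω) * (1 - π (X i ω))) (ε i) P :=
      (hm.indep_noise i).comp (φ := fun y => h y * (1 - π y)) (ψ := id)
        (hh.mul (measurable_const.sub hπ)) measurable_id
    rw [hi.integral_fun_mul_eq_mul_integral hmeas1.aestronglyMeasurable hε.aestronglyMeasurable,
      hm.noise_mean i, mul_zero]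
  calc ∫ ω, h (X i ω) * outcomeValue (s i ω) ∂P
      = ∫ ω, h (X i ω) * (P[fun ω => outcomeValue (s i ω) |
          MeasurableSpace.comap (fun ω => (X i ω, ε i ω)) inferInstance]) ω ∂P :=
        integral_mul_eq_integral_mul_condExp hle hXm hout fun ω => hC (X i ω)
    _ = ∫ ω, (h (X i ω) * ((1 - B i) * π (X i ω) + B i) +
          (h (X i ω) * (1 - π (X i ω))) * ε i ω) ∂P := by
        refine integral_congr_ae ?_
        filter_upwards [hb] with ω hω
        rw [hω]
        ring
    _ = _ := by rw [integral_add hint2 hint1, hzero, add_zero]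

theorem integral_kernel (hm : NoisyModel P π B σ X ε s) (N : Seminorm ℝ (Fin d → ℝ)) (Δ : ℝ)
    (x : Fin d → ℝ) (i : Fin t) : ∫ ω, kernel N Δ x (X i ω) ∂P = ballMass N Δ x := by
  have h := integral_map (μ := P) (hm.measurable_point i).aemeasurable
    (f := kernel N Δ x) (measurable_kernel N Δ x).aestronglyMeasurable
  rw [← h, hm.uniform i, ballMass]
  unfold kernel
  rw [integral_indicator_const _ (measurableSet_seminorm_ball N x Δ)]
  simp

theorem measurable_residual (hm : NoisyModel P π B σ X ε s) (hπ : Measurable π)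
    (N : Seminorm ℝ (Fin d → ℝ)) (Δ : ℝ) (x : Fin d → ℝ) (i : Fin t) :
    Measurable fun ω => residual N Δ x π (B i) (X i ω) (s i ω) := by
  have hX := hm.measurable_point i
  exact ((measurable_kernel N Δ x).comp hX).mul
    ((measurable_outcomeValue.comp (hm.measurable_outcome i)).sub
      (((hπ.comp hX).const_mul _).add_const _))

theorem integral_residual [IsProbabilityMeasure P] (hm : NoisyModel P π B σ X ε s) (hπ : Measurable π)
    (hπ01 : ∀ y, 0 ≤ π y ∧ π y ≤ 1) (hB : ∀ i, 0 ≤ B i ∧ B i ≤ 1)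
    (N : Seminorm ℝ (Fin d → ℝ)) (Δ : ℝ) (x : Fin d → ℝ) (i : Fin t) :
    ∫ ω, residual N Δ x π (B i) (X i ω) (s i ω) ∂P = 0 := by
  have hX := hm.measurable_point i
  have hk := (measurable_kernel N Δ x).comp hX
  have h := hm.integral_mul_outcome hπ hπ01 (measurable_kernel N Δ x) (abs_kernel_le N Δ x) i
  simp only [residual, mul_sub]
  rw [integral_sub, h, sub_self]
  · refine integrable_of_measurable_of_bounded
      (hk.mul (measurable_outcomeValue.comp (hm.measurable_outcome i))) 1 fun ω => ?_
    have h2 := outcomeValue_mem (s i ω)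
    rw [abs_mul]
    exact mul_le_one₀ (abs_kernel_le N Δ x _) (abs_nonneg _)
      (abs_le.mpr ⟨by linarith, by linarith⟩)
  · refine integrable_of_measurable_of_bounded
      (hk.mul (((hπ.comp hX).const_mul _).add_const _)) 1 fun ω => ?_
    have h1 := success_prob_mem (hB i) (hπ01 (X i ω))
    rw [abs_mul]
    exact mul_le_one₀ (abs_kernel_le N Δ x _) (abs_nonneg _)
      (abs_le.mpr ⟨by linarith, by linarith⟩)

/-- Since kernel and outcome take only the values 0 and 1, the square is `K(1 - 2p)s + Kp²`, affine
in `s`. The first-moment identity then replaces `s` by `p`, giving `Kp(1 - p)`, and `1 - p = (1 - B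
i)(1 - π) ≤ 1 - B i`. -/
theorem integral_residual_sq_le [IsProbabilityMeasure P] (hm : NoisyModel P π B σ X ε s) (hπ : Measurable π)
    (hπ01 : ∀ y, 0 ≤ π y ∧ π y ≤ 1) (hB : ∀ i, 0 ≤ B i ∧ B i ≤ 1)
    (N : Seminorm ℝ (Fin d → ℝ)) (Δ : ℝ) (x : Fin d → ℝ) (i : Fin t) :
    ∫ ω, residual N Δ x π (B i) (X i ω) (s i ω) ^ 2 ∂P ≤ (1 - B i) * ballMass N Δ x := by
  have hX := hm.measurable_point i
  have hk := measurable_kernel N Δ x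
  set p : (Fin d → ℝ) → ℝ := fun y => (1 - B i) * π y + B i with hp
  have hpm : Measurable p := (hπ.const_mul _).add_const _
  have hp01 : ∀ y, 0 ≤ p y ∧ p y ≤ 1 := fun y => success_prob_mem (hB i) (hπ01 y)
  set h : (Fin d → ℝ) → ℝ := fun y => kernel N Δ x y * (1 - 2 * p y) with hh
  have hhm : Measurable h := hk.mul (measurable_const.sub (hpm.const_mul _))
  have hhb : ∀ y, |h y| ≤ 1 := fun y => by
    have := hp01 y
    rw [hh, abs_mul]
    exact mul_le_one₀ (abs_kernel_le N Δ x y) (abs_nonneg _)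
      (abs_le.mpr ⟨by linarith, by linarith⟩)
  have hsq : ∀ y, |p y ^ 2| ≤ 1 := fun y => by
    rw [abs_of_nonneg (sq_nonneg _)]; exact pow_le_one₀ (hp01 y).1 (hp01 y).2
  have hI2 : Integrable (fun ω => kernel N Δ x (X i ω) * p (X i ω) ^ 2) P := by
    refine integrable_of_measurable_of_bounded
      ((hk.comp hX).mul ((hpm.comp hX).pow_const 2)) 1 fun ω => ?_
    rw [abs_mul]
    exact mul_le_one₀ (abs_kernel_le N Δ x _) (abs_nonneg _) (hsq _)
  have hI1 : Integrable (fun ω => h (X i ω) * outcomeValue (s i ω)) P := by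
    refine integrable_of_measurable_of_bounded
      ((hhm.comp hX).mul (measurable_outcomeValue.comp (hm.measurable_outcome i))) 1 fun ω => ?_
    have h2 := outcomeValue_mem (s i ω)
    rw [abs_mul]
    exact mul_le_one₀ (hhb _) (abs_nonneg _) (abs_le.mpr ⟨by linarith, by linarith⟩)
  have hI3 : Integrable (fun ω => h (X i ω) * p (X i ω)) P := by
    refine integrable_of_measurable_of_bounded ((hhm.comp hX).mul (hpm.comp hX)) 1 fun ω => ?_
    have h2 := hp01 (X i ω)
    rw [abs_mul]
    exact mul_le_one₀ (hhb _) (abs_nonneg _) (abs_le.mpr ⟨by linarith, by linarith⟩)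
  have hI4 : Integrable (fun ω => kernel N Δ x (X i ω)) P :=
    integrable_of_measurable_of_bounded (hk.comp hX) 1 fun ω => abs_kernel_le N Δ x _
  calc ∫ ω, residual N Δ x π (B i) (X i ω) (s i ω) ^ 2 ∂P
      = ∫ ω, (h (X i ω) * outcomeValue (s i ω) + kernel N Δ x (X i ω) * p (X i ω) ^ 2) ∂P := by
        refine integral_congr_ae (Filter.Eventually.of_forall fun ω => ?_)
        have ho : outcomeValue (s i ω) = 0 ∨ outcomeValue (s i ω) = 1 := by
          unfold outcomeValue; split_ifs <;> simp
        simp only [residual, hh, hp]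
        rcases kernel_eq_zero_or_one N Δ x (X i ω) with hk | hk <;> rcases ho with ho | ho <;>
          rw [hk, ho] <;> ring
    _ = ∫ ω, (h (X i ω) * p (X i ω) + kernel N Δ x (X i ω) * p (X i ω) ^ 2) ∂P := by
        rw [integral_add hI1 hI2, integral_add hI3 hI2,
          hm.integral_mul_outcome hπ hπ01 hhm hhb i]
    _ ≤ ∫ ω, (1 - B i) * kernel N Δ x (X i ω) ∂P := by
        refine integral_mono (hI3.add hI2) (hI4.const_mul _) fun ω => ?_
        have h1 := hp01 (X i ω)
        have h2 := hπ01 (X i ω)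
        have h3 : 1 - p (X i ω) ≤ 1 - B i := by
          have := mul_nonneg (sub_nonneg.mpr (hB i).2) h2.1
          simp only [hp]; linarith
        have h4 : p (X i ω) * (1 - p (X i ω)) ≤ 1 - B i :=
          (mul_le_of_le_one_left (by linarith) h1.2).trans h3
        simp only [hh]
        rcases kernel_eq_zero_or_one N Δ x (X i ω) with hk | hk <;> rw [hk]
        · simp
        · linarith
    _ = _ := by rw [integral_const_mul, hm.integral_kernel]

theorem integral_sum_residual_sq_le [IsProbabilityMeasure P] (hm : NoisyModel P π B σ X ε s) (hπ : Measurable π)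
    (hπ01 : ∀ y, 0 ≤ π y ∧ π y ≤ 1) (hB : ∀ i, 0 ≤ B i ∧ B i ≤ 1)
    (N : Seminorm ℝ (Fin d → ℝ)) (Δ : ℝ) (x : Fin d → ℝ) :
    ∫ ω, (∑ i, residual N Δ x π (B i) (X i ω) (s i ω)) ^ 2 ∂P ≤
      (∑ i, (1 - B i)) * ballMass N Δ x := by
  set V : Fin t → Ω → ℝ := fun i ω => residual N Δ x π (B i) (X i ω) (s i ω) with hV
  have hVm : ∀ i, Measurable (V i) := fun i => hm.measurable_residual hπ N Δ x i
  have hVL : ∀ i, MemLp (V i) 2 P := fun i =>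
    MemLp.of_bound (hVm i).aestronglyMeasurable 1
      (Filter.Eventually.of_forall fun ω => abs_residual_le N Δ x hπ01 (hB i) _ _)
  have hind : iIndepFun V P := by
    refine hm.indep.comp (fun i (z : (Fin d → ℝ) × ℝ × Bool) =>
      residual N Δ x π (B i) z.1 z.2.2) fun i => ?_
    exact ((measurable_kernel N Δ x).comp measurable_fst).mul
      ((measurable_outcomeValue.comp (measurable_snd.comp measurable_snd)).sub
        (((hπ.comp measurable_fst).const_mul _).add_const _))
  have hvar := IndepFun.variance_sum (s := Finset.univ) (fun i _ => hVL i)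
    fun i _ j _ hij => hind.indepFun hij
  have hmean : ∫ ω, (∑ i, V i) ω ∂P = 0 := by
    simp only [Finset.sum_apply]
    rw [integral_finsetSum _ fun i _ => (hVL i).integrable (by norm_num)]
    exact Finset.sum_eq_zero fun i _ => hm.integral_residual hπ hπ01 hB N Δ x i
  have hsm : Measurable (∑ i, V i) :=
    by convert! Finset.measurable_sum Finset.univ fun i _ => hVm i using 1; ext ω; simp
  rw [variance_of_integral_eq_zero hsm.aemeasurable hmean] at hvar
  simp only [Finset.sum_apply] at hvar
  rw [hvar, Finset.sum_mul]
  refine Finset.sum_le_sum fun i _ => ?_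
  rw [variance_of_integral_eq_zero (hVm i).aemeasurable (hm.integral_residual hπ hπ01 hB N Δ x i)]
  exact hm.integral_residual_sq_le hπ hπ01 hB N Δ x i

/-- Each summand lies in `[0, 1]`, so its square is at most itself and the variance of the sum is at
most its mean `μ`. Chebyshev at distance `μ/2` gives `μ / (μ/2)² = 4/μ`. -/
theorem measure_abs_sum_kernel_sub_ge_le [IsProbabilityMeasure P] (hm : NoisyModel P π B σ X ε s)
    (hB : ∀ i, 0 ≤ B i ∧ B i ≤ 1) (N : Seminorm ℝ (Fin d → ℝ)) (Δ : ℝ) (x : Fin d → ℝ)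
    (hμ : 0 < (∑ i, (1 - B i)) * ballMass N Δ x) :
    P {ω | (∑ i, (1 - B i)) * ballMass N Δ x / 2 ≤
        |∑ i, (1 - B i) * kernel N Δ x (X i ω) - (∑ i, (1 - B i)) * ballMass N Δ x|} ≤
      ENNReal.ofReal (4 / ((∑ i, (1 - B i)) * ballMass N Δ x)) := by
  set U : Fin t → Ω → ℝ := fun i ω => (1 - B i) * kernel N Δ x (X i ω) with hU
  set μ := (∑ i, (1 - B i)) * ballMass N Δ x with hμdef
  have hUm : ∀ i, Measurable (U i) := fun i =>
    ((measurable_kernel N Δ x).comp (hm.measurable_point i)).const_mul _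
  have hA : ∀ i, 0 ≤ 1 - B i ∧ 1 - B i ≤ 1 := fun i =>
    ⟨by linarith [(hB i).2], by linarith [(hB i).1]⟩
  have hUL : ∀ i, MemLp (U i) 2 P := fun i =>
    MemLp.of_bound (hUm i).aestronglyMeasurable 1 (Filter.Eventually.of_forall fun ω => by
      rw [Real.norm_eq_abs, hU, abs_mul]
      exact mul_le_one₀ (abs_le.mpr ⟨by linarith [(hA i).1], (hA i).2⟩) (abs_nonneg _)
        (abs_kernel_le N Δ x _))
  have hind : iIndepFun U P :=
    hm.indep.comp (fun i (z : (Fin d → ℝ) × ℝ × Bool) => (1 - B i) * kernel N Δ x z.1)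
      fun i => ((measurable_kernel N Δ x).comp measurable_fst).const_mul _
  have hvar := IndepFun.variance_sum (s := Finset.univ) (fun i _ => hUL i)
    fun i _ j _ hij => hind.indepFun hij
  have hEU : ∀ i, ∫ ω, U i ω ∂P = (1 - B i) * ballMass N Δ x := fun i => by
    rw [hU, integral_const_mul, hm.integral_kernel]
  have hmean : ∫ ω, (∑ i, U i) ω ∂P = μ := by
    simp only [Finset.sum_apply]
    rw [integral_finsetSum _ fun i _ => (hUL i).integrable (by norm_num), hμdef, Finset.sum_mul]
    exact Finset.sum_congr rfl fun i _ => hEU i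
  have hvar_le : variance (∑ i, U i) P ≤ μ := by
    rw [hvar, hμdef, Finset.sum_mul]
    refine Finset.sum_le_sum fun i _ => ?_
    refine (variance_le_expectation_sq (hUm i).aestronglyMeasurable).trans ?_
    rw [← hEU i]
    refine integral_mono (hUL i).integrable_sq ((hUL i).integrable (by norm_num)) fun ω => ?_
    simp only [Pi.pow_apply, hU]
    rcases kernel_eq_zero_or_one N Δ x (X i ω) with hk | hk <;> rw [hk]
    · simp
    · nlinarith [hA i]
  have hcheb := meas_ge_le_variance_div_sq (memLp_finsetSum' Finset.univ fun i _ => hUL i)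
    (half_pos hμ)
  rw [hmean] at hcheb
  simp only [Finset.sum_apply] at hcheb
  refine hcheb.trans (ENNReal.ofReal_le_ofReal ?_)
  rw [div_le_div_iff₀ (by positivity) hμ]
  nlinarith

end NoisyModel

/-! ### The risk bound -/

theorem sum_neighbors_eq_sum_kernel {d t : ℕ} (N : Seminorm ℝ (Fin d → ℝ)) (Δ : ℝ)
    (S : Fin t → Experiment d) (x : Fin d → ℝ) (f : Fin t → ℝ) :
    ∑ i ∈ neighbors N Δ S x, f i = ∑ i, kernel N Δ x (S i).point * f i := by
  rw [neighbors, Finset.sum_filter]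
  refine Finset.sum_congr rfl fun i _ => ?_
  simp [kernel, Set.indicator_apply]

theorem two_div_add_sq_le {μ w e b r : ℝ} (hμ : 0 < μ) (hw : μ / 2 < w) (hb : |b| ≤ w * r) :
    2 / w + 2 * ((e + b) / w) ^ 2 ≤ 4 / μ + 4 * r ^ 2 + 16 / μ ^ 2 * e ^ 2 := by
  have hw0 : 0 < w := by linarith
  have h1 : 2 / w ≤ 4 / μ := by rw [div_le_div_iff₀ hw0 hμ]; linarith
  have h2 : (b / w) ^ 2 ≤ r ^ 2 := by
    rw [div_pow, div_le_iff₀ (by positivity), ← mul_pow, mul_comm r w]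
    exact sq_le_sq' (by linarith [neg_abs_le b]) ((le_abs_self b).trans hb)
  have h3 : (e / w) ^ 2 ≤ 4 / μ ^ 2 * e ^ 2 := by
    rw [div_pow, div_le_iff₀ (by positivity)]
    have : 1 ≤ 4 / μ ^ 2 * w ^ 2 := by
      rw [div_mul_eq_mul_div, le_div_iff₀ (by positivity)]
      nlinarith
    nlinarith [mul_le_mul_of_nonneg_left this (sq_nonneg e)]
  have h4 : ((e + b) / w) ^ 2 ≤ 2 * (e / w) ^ 2 + 2 * (b / w) ^ 2 := by
    rw [add_div]; nlinarith [sq_nonneg (e / w - b / w)]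
  have h5 : 16 / μ ^ 2 * e ^ 2 = 4 * (4 / μ ^ 2 * e ^ 2) := by ring
  linarith

namespace NoisyModel

variable {d t : ℕ} {Ω : Type*} [MeasurableSpace Ω] {P : Measure Ω}
  {π : (Fin d → ℝ) → ℝ} {B : Fin t → ℝ} {σ : ℝ} {X : Fin t → Ω → Fin d → ℝ} {ε : Fin t → Ω → ℝ}
  {s : Fin t → Ω → Bool}

/-- The constant is `24 = 4 + 16 + 4`: posterior spread, variance of the centred sum, and
probability of the event of too little weight near `x`. -/
theorem lintegral_sq_sub_posterior_le_of_measurable [IsProbabilityMeasure P]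
    (hm : NoisyModel P π B σ X ε s) (hπ : Measurable π)
    (hπ01 : ∀ y, 0 ≤ π y ∧ π y ≤ 1) (hB : ∀ i, 0 ≤ B i ∧ B i ≤ 1)
    (N : Seminorm ℝ (Fin d → ℝ)) {L Δ : ℝ} (hL : 0 < L)
    (hLip : ∀ x ∈ Set.Icc (0 : Fin d → ℝ) 1, ∀ y ∈ Set.Icc (0 : Fin d → ℝ) 1,
      |π x - π y| ≤ L * N (x - y))
    {x : Fin d → ℝ} (hx : x ∈ Set.Icc (0 : Fin d → ℝ) 1)
    (hμ : 0 < (∑ i, (1 - B i)) * ballMass N Δ x) :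
    ∫⁻ ω, ∫⁻ θ, ENNReal.ofReal ((θ - π x) ^ 2)
        ∂(posterior N Δ (fun i => ⟨X i ω, s i ω, 1 - B i, B i⟩) x (fun _ => 1) (fun _ => 1)) ∂P ≤
      ENNReal.ofReal (24 / ((∑ i, (1 - B i)) * ballMass N Δ x) + 4 * (L * Δ) ^ 2) := by
  have hcheb := hm.measure_abs_sum_kernel_sub_ge_le hB N Δ x hμ
  have hsq := hm.integral_sum_residual_sq_le hπ hπ01 hB N Δ x
  set μ := (∑ i, (1 - B i)) * ballMass N Δ x with hμdef
  set W : Ω → ℝ := fun ω => ∑ i, (1 - B i) * kernel N Δ x (X i ω) with hW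
  set E : Ω → ℝ := fun ω => ∑ i, residual N Δ x π (B i) (X i ω) (s i ω) with hE
  have hWm : Measurable W := Finset.measurable_sum _ fun i _ =>
    ((measurable_kernel N Δ x).comp (hm.measurable_point i)).const_mul _
  have hEm : Measurable E := Finset.measurable_sum _ fun i _ => hm.measurable_residual hπ N Δ x i
  set bad : Set Ω := {ω | μ / 2 ≤ |W ω - μ|} with hbad
  have hbadm : MeasurableSet bad :=
    measurableSet_le measurable_const (hWm.sub_const μ).abs
  have hEi : Integrable (fun ω => E ω ^ 2) P := by
    refine integrable_of_measurable_of_bounded (hEm.pow_const 2) ((t : ℝ) ^ 2) fun ω => ?_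
    have : |E ω| ≤ t := by
      refine (Finset.abs_sum_le_sum_abs _ _).trans ?_
      refine (Finset.sum_le_sum fun i _ => abs_residual_le N Δ x hπ01 (hB i) _ _).trans ?_
      simp
    rw [abs_pow]
    exact pow_le_pow_left₀ (abs_nonneg _) this 2
  have hpt : ∀ᵐ ω ∂P, ∫⁻ θ, ENNReal.ofReal ((θ - π x) ^ 2)
        ∂(posterior N Δ (fun i => ⟨X i ω, s i ω, 1 - B i, B i⟩) x (fun _ => 1) (fun _ => 1)) ≤
      (ENNReal.ofReal (4 / μ + 4 * (L * Δ) ^ 2) + ENNReal.ofReal (16 / μ ^ 2 * E ω ^ 2)) +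
        bad.indicator 1 ω := by
    filter_upwards [ae_all_iff.mpr hm.ae_mem_cube] with ω hω
    set S : Fin t → Experiment d := fun i => ⟨X i ω, s i ω, 1 - B i, B i⟩ with hS
    by_cases hωb : ω ∈ bad
    · rw [Set.indicator_of_mem hωb]
      exact (lintegral_sq_sub_posterior_le_one N Δ S x (fun _ => rfl) (fun i => (hB i).1)
        (hπ01 x).1 (hπ01 x).2).trans le_add_self
    · rw [Set.indicator_of_notMem hωb, add_zero,
        ← ENNReal.ofReal_add (by positivity) (by positivity)]
      have hw : μ / 2 < W ω := by
        have := (abs_lt.mp (lt_of_not_ge (show ¬ μ / 2 ≤ |W ω - μ| from hωb))).1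
        linarith
      have hWsum : ∑ i ∈ neighbors N Δ S x, (1 - (S i).B) = W ω := by
        rw [sum_neighbors_eq_sum_kernel]
        exact Finset.sum_congr rfl fun i _ => mul_comm _ _
      have hEsum : ∑ i ∈ neighbors N Δ S x,
          ((if (S i).outcome = true then (1 : ℝ) else 0) -
            ((1 - (S i).B) * π x + (S i).B)) =
          E ω + ∑ i, (1 - B i) * kernel N Δ x (X i ω) * (π (X i ω) - π x) := by
        rw [sum_neighbors_eq_sum_kernel, hE, ← Finset.sum_add_distrib]
        refine Finset.sum_congr rfl fun i _ => ?_
        simp only [residual, outcomeValue, hS]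
        ring
      have hbias : |∑ i, (1 - B i) * kernel N Δ x (X i ω) * (π (X i ω) - π x)| ≤
          W ω * (L * Δ) := by
        rw [hW, Finset.sum_mul]
        refine (Finset.abs_sum_le_sum_abs _ _).trans (Finset.sum_le_sum fun i _ => ?_)
        have hA : 0 ≤ 1 - B i := by linarith [(hB i).2]
        by_cases hk : N (x - X i ω) ≤ Δ
        · have hk1 : kernel N Δ x (X i ω) = 1 := Set.indicator_of_mem (by exact hk) _
          rw [hk1, mul_one, abs_mul, abs_of_nonneg hA, abs_sub_comm]
          exact mul_le_mul_of_nonneg_left ((hLip x hx _ (hω i)).trans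
            (mul_le_mul_of_nonneg_left hk hL.le)) hA
        · have hk0 : kernel N Δ x (X i ω) = 0 := Set.indicator_of_notMem (by exact hk) _
          simp [hk0]
      refine (lintegral_sq_sub_posterior_le N Δ S x (fun _ => rfl) (fun i => (hB i).1)
        (hπ01 x).1 (by rw [hWsum]; linarith)).trans (ENNReal.ofReal_le_ofReal ?_)
      rw [hWsum, hEsum]
      exact two_div_add_sq_le hμ hw hbias
  refine (lintegral_mono_ae hpt).trans ?_
  rw [lintegral_add_right _ (measurable_one.indicator hbadm), lintegral_indicator_one hbadm,
    lintegral_add_left measurable_const, lintegral_const, measure_univ, mul_one,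
    ← ofReal_integral_eq_lintegral_ofReal (hEi.const_mul _)
      (Filter.Eventually.of_forall fun ω => by positivity), integral_const_mul]
  -- The second moment of `E` is at most `μ`, which cancels one factor.
  have h16 : 16 / μ ^ 2 * ∫ ω, E ω ^ 2 ∂P ≤ 16 / μ := by
    refine (mul_le_mul_of_nonneg_left hsq (by positivity)).trans_eq ?_
    field_simp
  refine (add_le_add (add_le_add le_rfl (ENNReal.ofReal_le_ofReal h16)) hcheb).trans ?_
  rw [← ENNReal.ofReal_add (by positivity) (by positivity),
    ← ENNReal.ofReal_add (by positivity) (by positivity)]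
  refine ENNReal.ofReal_le_ofReal (le_of_eq ?_)
  ring

/-- The function `π` is controlled on the cube only. Extending it by zero changes the model on a
null set at most and makes `π` globally measurable and bounded. -/
theorem indicator_cube (hm : NoisyModel P π B σ X ε s) :
    NoisyModel P ((Set.Icc (0 : Fin d → ℝ) 1).indicator π) B σ X ε s :=
  { hm with
    bernoulli := fun i => by
      filter_upwards [hm.bernoulli i, hm.ae_mem_cube i] with ω h1 h2
      rw [h1, Set.indicator_of_mem h2] }

theorem lintegral_sq_sub_posterior_le [IsProbabilityMeasure P]
    (hm : NoisyModel P π B σ X ε s)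
    (hπ01 : ∀ y ∈ Set.Icc (0 : Fin d → ℝ) 1, 0 ≤ π y ∧ π y ≤ 1) (hB : ∀ i, 0 ≤ B i ∧ B i ≤ 1)
    (N : Seminorm ℝ (Fin d → ℝ)) {L Δ : ℝ} (hL : 0 < L)
    (hLip : ∀ x ∈ Set.Icc (0 : Fin d → ℝ) 1, ∀ y ∈ Set.Icc (0 : Fin d → ℝ) 1,
      |π x - π y| ≤ L * N (x - y))
    {x : Fin d → ℝ} (hx : x ∈ Set.Icc (0 : Fin d → ℝ) 1)
    (hμ : 0 < (∑ i, (1 - B i)) * ballMass N Δ x) :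
    ∫⁻ ω, ∫⁻ θ, ENNReal.ofReal ((θ - π x) ^ 2)
        ∂(posterior N Δ (fun i => ⟨X i ω, s i ω, 1 - B i, B i⟩) x (fun _ => 1) (fun _ => 1)) ∂P ≤
      ENNReal.ofReal (24 / ((∑ i, (1 - B i)) * ballMass N Δ x) + 4 * (L * Δ) ^ 2) := by
  have hcont : ContinuousOn π (Set.Icc (0 : Fin d → ℝ) 1) := by
    obtain ⟨M, hM, hNM⟩ := exists_seminorm_le_mul_norm N
    refine LipschitzOnWith.continuousOn (K := NNReal.mk (L * M) (mul_nonneg hL.le (by linarith)))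
      (LipschitzOnWith.of_dist_le_mul fun u hu v hv => ?_)
    rw [dist_eq_norm, dist_eq_norm, Real.norm_eq_abs]
    refine (hLip u hu v hv).trans ?_
    rw [NNReal.coe_mk, mul_assoc]
    exact mul_le_mul_of_nonneg_left (hNM _) hL.le
  have hmeas : Measurable ((Set.Icc (0 : Fin d → ℝ) 1).indicator π) := by
    classical
    rw [← Set.piecewise_eq_indicator]
    exact hcont.measurable_piecewise continuousOn_const measurableSet_Icc
  have h01 : ∀ y, 0 ≤ (Set.Icc (0 : Fin d → ℝ) 1).indicator π y ∧
      (Set.Icc (0 : Fin d → ℝ) 1).indicator π y ≤ 1 := fun y => by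
    by_cases hy : y ∈ Set.Icc (0 : Fin d → ℝ) 1
    · rw [Set.indicator_of_mem hy]; exact hπ01 y hy
    · rw [Set.indicator_of_notMem hy]; exact ⟨le_rfl, zero_le_one⟩
  have h := hm.indicator_cube.lintegral_sq_sub_posterior_le_of_measurable hmeas h01 hB N hL
    (fun u hu v hv => by
      rw [Set.indicator_of_mem hu, Set.indicator_of_mem hv]; exact hLip u hu v hv) hx hμ
  rwa [Set.indicator_of_mem hx] at h

end NoisyModel

/-! ### The bandwidth -/

theorem bandwidth_pos {d t : ℕ} {L : ℝ} (hL : 0 < L) (ht : 0 < t) : 0 < bandwidth d L t :=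
  mul_pos (Real.rpow_pos_of_pos hL _) (Real.rpow_pos_of_pos (by exact_mod_cast ht) _)

/-- The balance that dictates the width: the squared bias scale `(LΔ)²` equals the variance scale `1
/ (t Δ^d)`. -/
theorem bandwidth_pow_mul {d t : ℕ} {L : ℝ} (hL : 0 < L) (ht : 0 < t) :
    bandwidth d L t ^ (d + 2) * (L ^ 2 * t) = 1 := by
  have ht' : (0 : ℝ) < t := by exact_mod_cast ht
  have hd : (d : ℝ) + 2 ≠ 0 := by positivity
  rw [bandwidth, mul_pow, ← Real.rpow_natCast, ← Real.rpow_natCast, ← Real.rpow_mul hL.le,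
    ← Real.rpow_mul ht'.le]
  push_cast
  rw [div_mul_cancel₀ _ hd, div_mul_cancel₀ _ hd, Real.rpow_neg hL.le, Real.rpow_neg ht'.le,
    Real.rpow_one, Real.rpow_two]
  field_simp

theorem bandwidth_le_one {d t : ℕ} {L : ℝ} (hL : 0 < L) (hLt : 1 ≤ L ^ 2 * t) :
    bandwidth d L t ≤ 1 := by
  have ht : 0 < t := Nat.pos_of_ne_zero fun h => by simp [h] at hLt; linarith
  have h := bandwidth_pow_mul (d := d) hL ht
  by_contra hc
  have h1 : 1 < bandwidth d L t ^ (d + 2) := one_lt_pow₀ (not_le.mp hc) (by omega)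
  nlinarith

theorem mul_bandwidth_sq {d t : ℕ} {L : ℝ} (hL : 0 < L) (ht : 0 < t) :
    (L * bandwidth d L t) ^ 2 =
      L ^ (2 * (d : ℝ) / ((d : ℝ) + 2)) * (t : ℝ) ^ (-2 / ((d : ℝ) + 2)) := by
  have ht' : (0 : ℝ) < t := by exact_mod_cast ht
  have hd : (d : ℝ) + 2 ≠ 0 := by positivity
  have h1 : L ^ (2 * (d : ℝ) / ((d : ℝ) + 2)) = L ^ 2 * (L ^ (-2 / ((d : ℝ) + 2))) ^ 2 := by
    rw [← Real.rpow_natCast L 2, ← Real.rpow_natCast (L ^ _) 2, ← Real.rpow_mul hL.le,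
      ← Real.rpow_add hL]
    congr 1
    push_cast
    field_simp
    ring
  have h2 : (t : ℝ) ^ (-2 / ((d : ℝ) + 2)) = ((t : ℝ) ^ (-1 / ((d : ℝ) + 2))) ^ 2 := by
    rw [← Real.rpow_natCast _ 2, ← Real.rpow_mul ht'.le]
    congr 1
    push_cast
    ring
  rw [h1, h2, bandwidth]
  ring

theorem pow_le_ballMass {d : ℕ} (N : Seminorm ℝ (Fin d → ℝ)) {M Δ : ℝ} (hM : 1 ≤ M)
    (hN : ∀ v, N v ≤ M * ‖v‖) {x : Fin d → ℝ} (hx : x ∈ Set.Icc (0 : Fin d → ℝ) 1)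
    (hΔ : 0 < Δ) (hΔ' : Δ ≤ 1) : (Δ / M) ^ d ≤ ballMass N Δ x := by
  refine (ENNReal.ofReal_le_iff_le_toReal ?_).mp (ofReal_pow_le_volume_ball N hM hN hx hΔ hΔ')
  refine ((measure_mono (Set.subset_univ _)).trans_lt ?_).ne
  rw [Measure.restrict_apply_univ, Real.volume_Icc_pi]
  simp

theorem exists_risk_bound (d : ℕ) (N : Seminorm ℝ (Fin d → ℝ)) :
    ∃ c : ℝ → ℝ → ℝ, ∀ (t : ℕ) (L : ℝ) (π : (Fin d → ℝ) → ℝ) (B : Fin t → ℝ) (σ : ℝ)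
        (Ω : Type*) [MeasurableSpace Ω] (P : Measure Ω) [IsProbabilityMeasure P]
        (X : Fin t → Ω → Fin d → ℝ) (ε : Fin t → Ω → ℝ) (s : Fin t → Ω → Bool),
        0 < L → 1 ≤ L ^ 2 * t →
        (∀ x ∈ Set.Icc (0 : Fin d → ℝ) 1, 0 < π x ∧ π x ≤ 1) →
        (∀ x ∈ Set.Icc (0 : Fin d → ℝ) 1, ∀ y ∈ Set.Icc (0 : Fin d → ℝ) 1,
          |π x - π y| ≤ L * N (x - y)) →
        (∀ i, 0 ≤ B i ∧ B i ≤ 1) → (∑ i, B i) / t < 1 →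
        NoisyModel P π B σ X ε s →
        ∀ x ∈ Set.Icc (0 : Fin d → ℝ) 1,
          ∫⁻ ω, ∫⁻ θ, ENNReal.ofReal ((θ - π x) ^ 2)
              ∂(posterior N (bandwidth d L t)
                (fun i => ⟨X i ω, s i ω, 1 - B i, B i⟩) x (fun _ => 1) (fun _ => 1)) ∂P ≤
            ENNReal.ofReal (c ((∑ i, B i) / t) (σ ^ 2) *
              L ^ (2 * (d : ℝ) / ((d : ℝ) + 2)) * (t : ℝ) ^ (-2 / ((d : ℝ) + 2))) := by
  obtain ⟨M, hM, hNM⟩ := exists_seminorm_le_mul_norm N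
  -- The first term comes from `24/μ` with `μ ≥ t(1 - b)(Δ/M)^d`, the `4` from the bias. The noise
  -- variance does not enter, as the noise has averaged out of the moments.
  refine ⟨fun b _ => 24 * M ^ d / (1 - b) + 4, ?_⟩
  intro t L π B σ Ω _ P _ X ε s hL hLt hπ hLip hB hb hm x hx
  have ht : 0 < t := Nat.pos_of_ne_zero fun h => by simp [h] at hLt; linarith
  have ht' : (0 : ℝ) < t := by exact_mod_cast ht
  have hΔ := bandwidth_pos (d := d) hL ht
  have hmass := pow_le_ballMass N hM hNM hx hΔ (bandwidth_le_one hL hLt)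
  have hpow := bandwidth_pow_mul (d := d) hL ht
  have hM0 : 0 < M := by linarith
  rw [mul_assoc _ (L ^ _), ← mul_bandwidth_sq hL ht]
  set Δ := bandwidth d L t
  set b := (∑ i, B i) / t with hbdef
  have hb0 : 0 < 1 - b := by linarith
  have hA : ∑ i, (1 - B i) = t * (1 - b) := by
    rw [Finset.sum_sub_distrib, mul_sub, hbdef, mul_div_cancel₀ _ ht'.ne']
    simp
  have hlow : 0 < t * (1 - b) * (Δ / M) ^ d := by positivity
  have hle : t * (1 - b) * (Δ / M) ^ d ≤ (∑ i, (1 - B i)) * ballMass N Δ x := by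
    rw [hA]
    exact mul_le_mul_of_nonneg_left hmass (by positivity)
  refine (hm.lintegral_sq_sub_posterior_le (fun y hy => ⟨(hπ y hy).1.le, (hπ y hy).2⟩) hB N hL
    hLip hx (hlow.trans_le hle)).trans (ENNReal.ofReal_le_ofReal ?_)
  have h24 : 24 / ((∑ i, (1 - B i)) * ballMass N Δ x) ≤ 24 * M ^ d / (1 - b) * (L * Δ) ^ 2 := by
    refine (div_le_div_of_nonneg_left (by norm_num) hlow hle).trans_eq ?_
    rw [div_pow]
    field_simp
    rw [← hpow]
    ring
  linarith

/-! ### Reasoning about programs -/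

/-- Program `Q`, started in memory `m`, halts after at most `T` steps in a memory satisfying
`post`. -/
def HaltsWithin {d : ℕ} (N : Seminorm ℝ (Fin d → ℝ)) (Q : Program) (m : Memory d) (T : ℕ)
    (post : Memory d → Prop) : Prop :=
  ∃ n m', n ≤ T ∧ Runs N Q m n m' ∧ post m'

namespace HaltsWithin

variable {d : ℕ} {N : Seminorm ℝ (Fin d → ℝ)} {m : Memory d} {post : Memory d → Prop}

theorem mono {Q : Program} {T T' : ℕ} {post' : Memory d → Prop} (h : HaltsWithin N Q m T post)
    (hT : T ≤ T') (hpost : ∀ m', post m' → post' m') : HaltsWithin N Q m T' post' := by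
  obtain ⟨n, m', hn, hr, hp⟩ := h
  exact ⟨n, m', hn.trans hT, hr, hpost m' hp⟩

theorem seq {Q R : Program} {T T' : ℕ}
    (h : HaltsWithin N Q m T fun m' => HaltsWithin N R m' T' post) :
    HaltsWithin N (.seq Q R) m (T + T') post := by
  obtain ⟨n, m', hn, hr, n', m'', hn', hr', hp⟩ := h
  exact ⟨n + n', m'', add_le_add hn hn', .seq hr hr', hp⟩

theorem idxConst {a c : ℕ} (h : post { m with idx := Function.update m.idx a c }) :
    HaltsWithin N (.idxConst a c) m 1 post := ⟨_, _, le_rfl, .idxConst a c m, h⟩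

theorem idxSucc {a b : ℕ} (h : post { m with idx := Function.update m.idx a (m.idx b + 1) }) :
    HaltsWithin N (.idxSucc a b) m 1 post := ⟨_, _, le_rfl, .idxSucc a b m, h⟩

theorem idxPred {a b : ℕ} (h : post { m with idx := Function.update m.idx a (m.idx b - 1) }) :
    HaltsWithin N (.idxPred a b) m 1 post := ⟨_, _, le_rfl, .idxPred a b m, h⟩

theorem regConst {r : ℕ} {q : ℚ} (h : post { m with reg := Function.update m.reg r (q : ℝ) }) :
    HaltsWithin N (.regConst r q) m 1 post := ⟨_, _, le_rfl, .regConst r q m, h⟩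

theorem regOfIdx {r a : ℕ} (h : post { m with reg := Function.update m.reg r (m.idx a : ℝ) }) :
    HaltsWithin N (.regOfIdx r a) m 1 post := ⟨_, _, le_rfl, .regOfIdx r a m, h⟩

theorem regOp {o : ArithOp} {r p q : ℕ}
    (h : post { m with reg := Function.update m.reg r (o.eval (m.reg p) (m.reg q)) }) :
    HaltsWithin N (.regOp o r p q) m 1 post := ⟨_, _, le_rfl, .regOp o r p q m, h⟩

theorem load {r k a : ℕ} (h : post { m with reg := Function.update m.reg r (m.arr k (m.idx a)) }) :
    HaltsWithin N (.load r k a) m 1 post := ⟨_, _, le_rfl, .load r k a m, h⟩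

theorem store {k a r : ℕ}
    (h : post { m with arr := Function.update m.arr k
                                (Function.update (m.arr k) (m.idx a) (m.reg r)) }) :
    HaltsWithin N (.store k a r) m 1 post := ⟨_, _, le_rfl, .store k a r m, h⟩

theorem dist {r a b : ℕ}
    (h : post { m with reg := Function.update m.reg r (N (m.pts (m.idx a) - m.pts (m.idx b))) }) :
    HaltsWithin N (.dist r a b) m 1 post := ⟨_, _, le_rfl, .dist r a b m, h⟩

theorem ifRegLe {p q : ℕ} {Q R : Program} {T : ℕ}
    (h : if m.reg p ≤ m.reg q then HaltsWithin N Q m T post else HaltsWithin N R m T post) :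
    HaltsWithin N (.ifRegLe p q Q R) m (T + 1) post := by
  by_cases hc : m.reg p ≤ m.reg q
  · rw [if_pos hc] at h
    obtain ⟨n, m', hn, hr, hp⟩ := h
    exact ⟨n + 1, m', Nat.succ_le_succ hn, .ifRegLe_true hc hr, hp⟩
  · rw [if_neg hc] at h
    obtain ⟨n, m', hn, hr, hp⟩ := h
    exact ⟨n + 1, m', Nat.succ_le_succ hn, .ifRegLe_false hc hr, hp⟩

/-- The invariant is indexed by the number of completed iterations, and the induction runs on those
remaining. Each iteration pays one extra step for its test; the final `+ 1` is the failing test. -/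
theorem whileIdxLt {I : ℕ → Memory d → Prop} {a b : ℕ} {Q : Program} {T J : ℕ}
    (hstep : ∀ j < J, ∀ m, I j m → m.idx a < m.idx b ∧ HaltsWithin N Q m T (I (j + 1)))
    (hexit : ∀ m, I J m → ¬ m.idx a < m.idx b) (h0 : I 0 m) :
    HaltsWithin N (.whileIdxLt a b Q) m (J * (T + 1) + 1) (I J) := by
  suffices h : ∀ r j m, j + r = J → I j m →
      HaltsWithin N (.whileIdxLt a b Q) m (r * (T + 1) + 1) (I J) from h J 0 m (zero_add J) h0
  intro r
  induction r with
  | zero =>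
    intro j m hj hI
    obtain rfl : j = J := hj
    have hend : Runs N (.whileIdxLt a b Q) m 1 m := by
      constructor
      exact hexit m hI
    exact ⟨1, m, by simp, hend, hI⟩
  | succ r ih =>
    intro j m hj hI
    obtain ⟨hlt, n, m', hn, hr, hp⟩ := hstep j (by omega) m hI
    obtain ⟨n', m'', hn', hr', hp'⟩ := ih (j + 1) m' (by omega) hp
    refine ⟨n + n' + 1, m'', ?_, .while_step hlt hr hr', hp'⟩
    rw [add_mul]
    omega

end HaltsWithin

/-! ### The posterior weights by a recursion -/

/-- The weight of index `k - j`, relative to that of index `k`, in the posterior mixture with `a`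
failures. -/
noncomputable def relWeight (B : ℝ) (a j : ℕ) : ℝ := ((a + j).choose j : ℝ) * B ^ j

theorem relWeight_zero (B : ℝ) (a : ℕ) : relWeight B a 0 = 1 := by simp [relWeight]

/-- This recursion keeps the cost per weight constant: no factorial or Gamma value is ever computed.
-/
theorem relWeight_succ (B : ℝ) (a j : ℕ) :
    relWeight B a (j + 1) = relWeight B a j * B * (a + (j + 1 : ℕ)) / (j + 1 : ℕ) := by
  have h := Nat.add_one_mul_choose_eq (a + j) j
  have h' : ((a : ℝ) + j + 1) * (a + j).choose j = (a + (j + 1)).choose (j + 1) * (j + 1) := by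
    exact_mod_cast h
  have hj : ((j + 1 : ℕ) : ℝ) ≠ 0 := by positivity
  rw [eq_div_iff hj, relWeight, relWeight]
  push_cast
  rw [pow_succ]
  linear_combination (-(B ^ j * B)) * h'

/-- Writing the binomials by factorials, `choose k i * i! * (n-i)! = k! * (n-k)! * choose (n-i)
(k-i)`; the prefactor is independent of `i` and cancels on normalising. -/
theorem simpleWeight_eq_relWeight {B : ℝ} {n k i : ℕ} (hi : i ≤ k) (hk : k ≤ n) :
    simpleWeight 1 1 B n k i =
      (k.factorial * (n - k).factorial : ℝ) * relWeight B (n - k) (k - i) := by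
  have h1 : Real.Gamma (1 + i) = i.factorial := by rw [add_comm, Real.Gamma_nat_eq_factorial]
  have h2 : Real.Gamma (1 + n - i) = (n - i).factorial := by
    rw [show (1 : ℝ) + n - i = ((n - i : ℕ) : ℝ) + 1 by rw [Nat.cast_sub (hi.trans hk)]; ring,
      Real.Gamma_nat_eq_factorial]
  have h3 : (k.choose i * i.factorial * (k - i).factorial : ℝ) = k.factorial := by
    exact_mod_cast Nat.choose_mul_factorial_mul_factorial hi
  have h4 : ((n - k + (k - i)).choose (k - i) * (k - i).factorial * (n - k).factorial : ℝ) =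
      (n - i).factorial := by
    have := Nat.choose_mul_factorial_mul_factorial (show k - i ≤ n - k + (k - i) by omega)
    rw [show n - k + (k - i) - (k - i) = n - k by omega,
      show (n - k + (k - i)).factorial = (n - i).factorial by congr 1; omega] at this
    exact_mod_cast this
  rw [simpleWeight, relWeight, h1, h2, ← h3, ← h4]
  ring

theorem sum_simpleWeight_eq {B : ℝ} {n k : ℕ} (hk : k ≤ n) :
    ∑ i ∈ Finset.range (k + 1), simpleWeight 1 1 B n k i =
      (k.factorial * (n - k).factorial : ℝ) *
        ∑ j ∈ Finset.range (k + 1), relWeight B (n - k) j := by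
  rw [Finset.mul_sum, ← Finset.sum_range_reflect]
  refine Finset.sum_congr rfl fun j hj => ?_
  have : j ≤ k := Nat.lt_succ_iff.mp (by simpa using hj)
  rw [simpleWeight_eq_relWeight (by omega) hk]
  congr 2
  omega

theorem simpleCoeff_eq_relWeight {B : ℝ} {n k i : ℕ} (hk : k ≤ n) :
    simpleCoeff 1 1 B n k i = if i ≤ k then relWeight B (n - k) (k - i) /
      ∑ j ∈ Finset.range (k + 1), relWeight B (n - k) j else 0 := by
  split_ifs with hi
  · rw [simpleCoeff, simpleWeight_eq_relWeight hi hk, sum_simpleWeight_eq hk]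
    exact mul_div_mul_left _ _ (by positivity)
  · simp [simpleCoeff, simpleWeight, Nat.choose_eq_zero_of_lt (not_le.mp hi)]

/-- The formula also covers the case without neighbours, where its value is `1 / 1`, so the program
needs no separate branch. -/
theorem coeff_eq_relWeight {d t : ℕ} (N : Seminorm ℝ (Fin d → ℝ)) (Δ : ℝ)
    (S : Fin t → Experiment d) (x : Fin d → ℝ) (hA : ∀ i, (S i).A = 1 - (S i).B) {i : ℕ}
    (hi : i ≤ neighborCount N Δ S x) :
    coeff N Δ S x 1 1 i = if i ≤ successCount N Δ S x then
      relWeight (meanB N Δ S x) (neighborCount N Δ S x - successCount N Δ S x)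
          (successCount N Δ S x - i) /
        ∑ j ∈ Finset.range (successCount N Δ S x + 1),
          relWeight (meanB N Δ S x) (neighborCount N Δ S x - successCount N Δ S x) j else 0 := by
  have hk := successCount_le_neighborCount N Δ S x
  rcases Nat.eq_zero_or_pos (neighborCount N Δ S x) with h | h
  · have hk0 : successCount N Δ S x = 0 := by omega
    have hi0 : i = 0 := by omega
    rw [hi0, coeff_zero_of_neighborCount_eq_zero N Δ S x h, hk0]
    simp [relWeight_zero]
  · rw [coeff_eq_simpleCoeff N Δ S x hA h, simpleCoeff_eq_relWeight hk]

/-! ### The program -/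

/-- Compute the kernel width in register `2`. -/
def bandwidthProgram (d : ℕ) : Program :=
  .seq (.regConst 1 (-2 / ((d : ℚ) + 2))) <| .seq (.regOp .pow 2 0 1) <|
  .seq (.regConst 1 (-1 / ((d : ℚ) + 2))) <| .seq (.regOfIdx 4 0) <|
  .seq (.regOp .pow 4 4 1) (.regOp .mul 2 2 4)

/-- Account for the experiment in index register `1`. -/
def countProgram : Program :=
  .seq (.idxSucc 2 2) <| .seq (.load 4 2 1) <| .seq (.regOp .add 3 3 4) <| .seq (.load 4 0 1) <|
  .seq (.regConst 5 1) (.ifRegLe 5 4 (.idxSucc 3 3) (.idxConst 6 0))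

/-- Account for the experiment in index register `1` if it is a neighbour, and go to the next. -/
def scanStepProgram : Program :=
  .seq (.idxSucc 4 1) <| .seq (.dist 1 5 4) <|
  .seq (.ifRegLe 1 2 countProgram (.idxConst 6 0)) (.idxSucc 1 1)

/-- Store the mean of the parameters `Bᵢ` and set the first entries of array `0` to zero. -/
def clearProgram : Program :=
  .seq (.regOfIdx 4 2) <| .seq (.regOp .div 3 3 4) <| .seq (.regConst 7 0) <|
  .seq (.idxConst 1 0) <| .seq (.idxSucc 6 2) (.whileIdxLt 1 6 (.seq (.store 0 1 7) (.idxSucc 1 1)))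

/-- One step of the recursion for the weights. -/
def weightStepProgram : Program :=
  .seq (.store 0 4 4) <| .seq (.regOp .add 5 5 4) <| .seq (.idxSucc 1 1) <|
  .seq (.regOfIdx 7 1) <| .seq (.regOp .mul 4 4 3) <| .seq (.regOp .add 8 6 7) <|
  .seq (.regOp .mul 4 4 8) <| .seq (.regOp .div 4 4 7) (.idxPred 4 4)

/-- Compute the unnormalised weights in array `0` and their sum in register `5`. -/
def weightProgram : Program :=
  -- A successor followed by a predecessor copies an index register.
  .seq (.idxConst 1 0) <| .seq (.idxSucc 4 3) <| .seq (.idxPred 4 4) <| .seq (.idxSucc 6 3) <|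
  .seq (.regConst 4 1) <| .seq (.regConst 5 0) <| .seq (.regOfIdx 6 2) <| .seq (.regOfIdx 7 3) <|
  .seq (.regOp .sub 6 6 7) (.whileIdxLt 1 6 weightStepProgram)

/-- Divide the weights by their sum, and store the number of neighbours in index register `0`. -/
def normalizeProgram : Program :=
  .seq (.idxConst 1 0) <| .seq (.whileIdxLt 1 6
    (.seq (.load 4 0 1) <| .seq (.regOp .div 4 4 5) <| .seq (.store 0 1 4) (.idxSucc 1 1))) <|
  .seq (.idxSucc 0 2) (.idxPred 0 0)

/-- The contextual smooth Beta process for the uniform prior. -/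
def posteriorProgram (d : ℕ) : Program :=
  .seq (bandwidthProgram d) <| .seq (.whileIdxLt 1 0 scanStepProgram) <|
  .seq clearProgram <| .seq weightProgram normalizeProgram

/-! ### Correctness of the scan over the experiments -/

section Correctness

variable {d t : ℕ} (N : Seminorm ℝ (Fin d → ℝ)) (Δ L : ℝ) (S : Fin t → Experiment d)
  (x : Fin d → ℝ)

/-- The neighbours among the first `j` experiments. -/
noncomputable def prefixNeighbors (j : ℕ) : Finset (Fin t) :=
  (neighbors N Δ S x).filter fun i => (i : ℕ) < j

theorem prefixNeighbors_zero : prefixNeighbors N Δ S x 0 = ∅ := by simp [prefixNeighbors]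

theorem prefixNeighbors_self : prefixNeighbors N Δ S x t = neighbors N Δ S x := by
  simp [prefixNeighbors]

theorem notMem_prefixNeighbors (i : Fin t) : i ∉ prefixNeighbors N Δ S x i := by
  simp [prefixNeighbors]

theorem prefixNeighbors_succ_of_le (i : Fin t) (h : N (x - (S i).point) ≤ Δ) :
    prefixNeighbors N Δ S x (i + 1) = insert i (prefixNeighbors N Δ S x i) := by
  ext k
  simp only [prefixNeighbors, neighbors, Finset.mem_filter, Finset.mem_univ, true_and,
    Finset.mem_insert]
  constructor
  · rintro ⟨h1, h2⟩
    rcases eq_or_ne k i with rfl | hne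
    · exact Or.inl rfl
    · have := Fin.val_ne_of_ne hne
      exact Or.inr ⟨h1, by omega⟩
  · rintro (rfl | ⟨h1, h2⟩)
    · exact ⟨h, by omega⟩
    · exact ⟨h1, by omega⟩

theorem prefixNeighbors_succ_of_not_le (i : Fin t) (h : ¬ N (x - (S i).point) ≤ Δ) :
    prefixNeighbors N Δ S x (i + 1) = prefixNeighbors N Δ S x i := by
  ext k
  simp only [prefixNeighbors, neighbors, Finset.mem_filter, Finset.mem_univ, true_and]
  constructor
  · rintro ⟨h1, h2⟩
    have hne : k ≠ i := by rintro rfl; exact h h1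
    have := Fin.val_ne_of_ne hne
    exact ⟨h1, by omega⟩
  · rintro ⟨h1, h2⟩
    exact ⟨h1, by omega⟩

/-- The state of the memory after the first `j` experiments have been scanned. -/
structure ScanInvariant (j : ℕ) (m : Memory d) : Prop where
  idx_zero : m.idx 0 = t
  idx_one : m.idx 1 = j
  idx_two : m.idx 2 = (prefixNeighbors N Δ S x j).card
  idx_three : m.idx 3 = ((prefixNeighbors N Δ S x j).filter fun i => (S i).outcome = true).card
  idx_five : m.idx 5 = 0
  reg_two : m.reg 2 = Δ
  reg_three : m.reg 3 = ∑ i ∈ prefixNeighbors N Δ S x j, (S i).B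
  arr : m.arr = (input L S x).arr
  pts : m.pts = (input L S x).pts

theorem haltsWithin_bandwidthProgram :
    HaltsWithin N (bandwidthProgram d) (input L S x) 6
      (ScanInvariant N (bandwidth d L t) L S x 0) := by
  refine .seq <| .regConst <| .seq <| .regOp <| .seq <| .regConst <| .seq <| .regOfIdx <|
    .seq <| .regOp <| .regOp ?_
  constructor <;>
    simp [input, ArithOp.eval, bandwidth, prefixNeighbors_zero]

theorem haltsWithin_scanStepProgram {j : ℕ} (hj : j < t) {m : Memory d}
    (h : ScanInvariant N Δ L S x j m) :
    HaltsWithin N scanStepProgram m 11 (ScanInvariant N Δ L S x (j + 1)) := by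
  obtain ⟨h0, h1, h2, h3, h5, r2, r3, ha, hp⟩ := h
  -- Index register 5 stays zero and so addresses the query point; the experiments are shifted by
  -- one position in the array of points.
  have hdist : N (m.pts (m.idx 5) - m.pts (m.idx 1 + 1)) = N (x - (S ⟨j, hj⟩).point) := by
    rw [hp, h5, h1]; simp [input, hj]
  have hB : (input L S x).arr 2 j = (S ⟨j, hj⟩).B := by simp [input, hj]
  have ho : (input L S x).arr 0 j = if (S ⟨j, hj⟩).outcome then 1 else 0 := by simp [input, hj]
  have hnot : ⟨j, hj⟩ ∉ prefixNeighbors N Δ S x j := notMem_prefixNeighbors N Δ S x ⟨j, hj⟩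
  refine .seq (T := 1) (T' := 10) <| .idxSucc <| .seq (T := 1) (T' := 9) <| .dist <|
    .seq (T := 8) (T' := 1) <| .ifRegLe (T := 7) ?_
  split_ifs with hc
  · have hc' : N (x - (S ⟨j, hj⟩).point) ≤ Δ := by simpa [hdist, r2] using hc
    have hpre := prefixNeighbors_succ_of_le N Δ S x ⟨j, hj⟩ hc'
    refine .seq (T := 1) <| .idxSucc <| .seq (T := 1) <| .load <| .seq (T := 1) <| .regOp <|
      .seq (T := 1) <| .load <| .seq (T := 1) <| .regConst <| .ifRegLe (T := 1) ?_
    split_ifs with hs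
    · have hs' : (S ⟨j, hj⟩).outcome = true := by
        by_contra hf
        simp [ha, h1, ho, hf] at hs
        linarith
      refine .idxSucc <| .idxSucc ?_
      constructor <;> simp [h0, h1, h2, h3, h5, r2, r3, ha, hp, hpre, hnot, hs', ArithOp.eval,
        Finset.filter_insert, add_comm, hB]
    · have hs' : (S ⟨j, hj⟩).outcome = false := by
        by_contra hf
        rw [Bool.not_eq_false] at hf
        simp [ha, h1, ho, hf] at hs
      -- Writing index register 6 serves as a no-op: the scan invariant does not mention it.
      refine .idxConst <| .idxSucc ?_
      constructor <;> simp [h0, h1, h2, h3, h5, r2, r3, ha, hp, hpre, hnot, hs', ArithOp.eval,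
        Finset.filter_insert, add_comm, hB]
  · have hc' : ¬ N (x - (S ⟨j, hj⟩).point) ≤ Δ := by simpa [hdist, r2] using hc
    have hpre := prefixNeighbors_succ_of_not_le N Δ S x ⟨j, hj⟩ hc'
    refine HaltsWithin.mono (T := 1) (.idxConst <| .idxSucc ?_) (by norm_num) fun _ h => h
    constructor <;> simp [h0, h1, h2, h3, h5, r2, r3, ha, hp, hpre]

theorem haltsWithin_scan {m : Memory d} (h : ScanInvariant N Δ L S x 0 m) :
    HaltsWithin N (.whileIdxLt 1 0 scanStepProgram) m (t * 12 + 1)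
      (ScanInvariant N Δ L S x t) := by
  refine .whileIdxLt (I := ScanInvariant N Δ L S x) (T := 11) (fun j hj m hI => ⟨?_, ?_⟩)
    (fun m hI => ?_) h
  · rw [hI.idx_zero, hI.idx_one]; exact hj
  · exact haltsWithin_scanStepProgram N Δ L S x hj hI
  · rw [hI.idx_zero, hI.idx_one]; exact lt_irrefl t

end Correctness

/-! ### Correctness of clearing, filling and normalising the weights -/

section Weights

variable {d : ℕ} {N : Seminorm ℝ (Fin d → ℝ)} {n k : ℕ} {B : ℝ}

/-- The state of the memory after the first `j` entries of array `0` have been cleared. -/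
structure ClearInvariant (n k : ℕ) (B : ℝ) (j : ℕ) (m : Memory d) : Prop where
  idx_one : m.idx 1 = j
  idx_two : m.idx 2 = n
  idx_three : m.idx 3 = k
  idx_six : m.idx 6 = n + 1
  reg_three : m.reg 3 = B
  reg_seven : m.reg 7 = 0
  arr_zero : ∀ p < j, m.arr 0 p = 0

/-- Array 0 still holds the outcomes, while the weights of index `k < i ≤ n` must end up zero. -/
theorem haltsWithin_clearProgram {m : Memory d} (h2 : m.idx 2 = n) (h3 : m.idx 3 = k)
    (hB : m.reg 3 / n = B) :
    HaltsWithin N clearProgram m ((n + 1) * 3 + 6) (ClearInvariant n k B (n + 1)) := by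
  refine HaltsWithin.mono (T := 1 + (1 + (1 + (1 + (1 + ((n + 1) * (2 + 1) + 1))))))
    (.seq <| .regOfIdx <| .seq <| .regOp <| .seq <| .regConst <| .seq <| .idxConst <|
      .seq <| .idxSucc <| .whileIdxLt (I := ClearInvariant n k B) (T := 2) ?_ ?_ ?_)
    (by omega) fun _ h => h
  · rintro j hj m ⟨h1, h2, h3, h6, r3, r7, ha⟩
    refine ⟨by omega, .seq (T := 1) <| .store <| .idxSucc ?_⟩
    constructor <;> simp [h1, h2, h3, h6, r3, r7, Function.update_apply]
    intro p hp hne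
    exact ha p (by omega)
  · rintro m ⟨h1, h2, h3, h6, r3, r7, ha⟩
    omega
  · constructor <;> simp [h2, h3, hB, ArithOp.eval]

/-- The state of the memory after the first `j` relative weights have been computed. -/
structure WeightInvariant (n k : ℕ) (B : ℝ) (j : ℕ) (m : Memory d) : Prop where
  idx_one : m.idx 1 = j
  idx_two : m.idx 2 = n
  idx_four : m.idx 4 = k - j
  idx_six : m.idx 6 = k + 1
  reg_three : m.reg 3 = B
  reg_four : m.reg 4 = relWeight B (n - k) j
  reg_five : m.reg 5 = ∑ i ∈ Finset.range j, relWeight B (n - k) i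
  reg_six : m.reg 6 = (n - k : ℕ)
  arr_zero : ∀ p ≤ n, m.arr 0 p =
    if p ≤ k ∧ k - p < j then relWeight B (n - k) (k - p) else 0

theorem haltsWithin_weightStepProgram {j : ℕ} (hj : j < k + 1) {m : Memory d}
    (h : WeightInvariant n k B j m) :
    HaltsWithin N weightStepProgram m 9 (WeightInvariant n k B (j + 1)) := by
  obtain ⟨h1, h2, h4, h6, r3, r4, r5, r6, ha⟩ := h
  refine .seq (T := 1) (T' := 8) <| .store <| .seq (T := 1) (T' := 7) <| .regOp <|
    .seq (T := 1) (T' := 6) <| .idxSucc <| .seq (T := 1) (T' := 5) <| .regOfIdx <|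
    .seq (T := 1) (T' := 4) <| .regOp <| .seq (T := 1) (T' := 3) <| .regOp <|
    .seq (T := 1) (T' := 2) <| .regOp <| .seq (T := 1) (T' := 1) <| .regOp <| .idxPred ?_
  constructor
  case arr_zero =>
    intro p hp
    simp only [Function.update_self, Function.update_apply, h4, r4]
    by_cases hpj : p = k - j
    · rw [if_pos hpj, if_pos (by omega), show k - p = j by omega]
    · rw [if_neg hpj, ha p hp]
      refine if_congr ?_ rfl rfl
      omega
  case reg_four => simp [h1, r3, r4, r6, ArithOp.eval, relWeight_succ]
  case reg_five => simp [r4, r5, ArithOp.eval, Finset.sum_range_succ]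
  -- After the last weight, `j = k`, the predecessor stays at zero, in agreement with `k - (k + 1) =
  -- 0`.
  case idx_four => simp [h4, Nat.sub_sub]
  all_goals simp [h1, h2, h6, r3, r6]

theorem haltsWithin_weightProgram (hk : k ≤ n) {m : Memory d}
    (h : ClearInvariant n k B (n + 1) m) :
    HaltsWithin N weightProgram m ((k + 1) * 10 + 10) (WeightInvariant n k B (k + 1)) := by
  obtain ⟨h1, h2, h3, h6, r3, r7, ha⟩ := h
  refine HaltsWithin.mono
    (T := 1 + (1 + (1 + (1 + (1 + (1 + (1 + (1 + (1 + ((k + 1) * (9 + 1) + 1))))))))))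
    (.seq <| .idxConst <| .seq <| .idxSucc <| .seq <| .idxPred <| .seq <| .idxSucc <|
      .seq <| .regConst <| .seq <| .regConst <| .seq <| .regOfIdx <| .seq <| .regOfIdx <|
      .seq <| .regOp <| .whileIdxLt (I := WeightInvariant n k B) (T := 9) ?_ ?_ ?_)
    (by omega) fun _ h => h
  · intro j hj m hI
    refine ⟨?_, haltsWithin_weightStepProgram hj hI⟩
    rw [hI.idx_one, hI.idx_six]; exact hj
  · intro m hI
    rw [hI.idx_one, hI.idx_six]; exact lt_irrefl _
  · constructor
    case arr_zero =>
      intro p hp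
      rw [if_neg (by omega)]
      exact ha p (by omega)
    all_goals simp [h2, h3, r3, relWeight_zero, ArithOp.eval, Nat.cast_sub hk]

/-- The state of the memory after the first `j` weights have been normalised. -/
structure NormalizeInvariant (n k : ℕ) (B : ℝ) (j : ℕ) (m : Memory d) : Prop where
  idx_one : m.idx 1 = j
  idx_two : m.idx 2 = n
  idx_six : m.idx 6 = k + 1
  reg_five : m.reg 5 = ∑ i ∈ Finset.range (k + 1), relWeight B (n - k) i
  arr_zero : ∀ p ≤ n, m.arr 0 p = if p ≤ k then
    (if p < j then relWeight B (n - k) (k - p) / ∑ i ∈ Finset.range (k + 1), relWeight B (n - k) i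
      else relWeight B (n - k) (k - p)) else 0

theorem haltsWithin_normalizeProgram {m : Memory d}
    (h : WeightInvariant n k B (k + 1) m) :
    HaltsWithin N normalizeProgram m ((k + 1) * 5 + 4) fun m' =>
      m'.idx 0 = n ∧ ∀ p ≤ n, m'.arr 0 p = if p ≤ k then
        relWeight B (n - k) (k - p) / ∑ i ∈ Finset.range (k + 1), relWeight B (n - k) i else 0 := by
  obtain ⟨h1, h2, h4, h6, r3, r4, r5, r6, ha⟩ := h
  refine HaltsWithin.mono (T := 1 + ((k + 1) * (4 + 1) + 1 + 2))
    (.seq <| .idxConst <| .seq <| HaltsWithin.mono (.whileIdxLt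
      (I := NormalizeInvariant n k B) (T := 4) ?_ ?_ ?_) le_rfl fun m hI => ?_)
    (by omega) fun _ h => h
  · rintro j hj m ⟨h1, h2, h6, r5, ha⟩
    refine ⟨by omega, .seq (T := 1) (T' := 3) <| .load <| .seq (T := 1) (T' := 2) <| .regOp <|
      .seq (T := 1) (T' := 1) <| .store <| .idxSucc ?_⟩
    constructor
    case arr_zero =>
      intro p hp
      simp only [Function.update_self, Function.update_apply, h1, ArithOp.eval]
      by_cases hpj : p = j
      · subst hpj
        simp [ha p hp, r5, show p ≤ k by omega]
      · rw [if_neg hpj, ha p hp]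
        simp only [show p < j + 1 ↔ p < j by omega]
    all_goals simp [h1, h2, h6, r5]
  · intro m hI
    rw [hI.idx_one, hI.idx_six]; exact lt_irrefl _
  · constructor
    case arr_zero =>
      intro p hp
      rw [ha p hp]
      simp only [Nat.not_lt_zero, if_false]
      refine if_congr ?_ rfl rfl
      omega
    all_goals simp [h2, h6, r5]
  · refine .seq (T := 1) (T' := 1) <| .idxSucc <| .idxPred ⟨?_, ?_⟩
    · simp [hI.idx_two]
    · intro p hp
      refine (hI.arr_zero p hp).trans ?_
      by_cases hpk : p ≤ k
      · simp [hpk, Nat.lt_succ_of_le hpk]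
      · simp [hpk]

end Weights

/-! ### The whole program and the final theorem -/

theorem haltsWithin_posteriorProgram {d t : ℕ} (N : Seminorm ℝ (Fin d → ℝ)) (L : ℝ)
    (S : Fin t → Experiment d) (x : Fin d → ℝ) (ht : 1 ≤ t) (hA : ∀ i, (S i).A = 1 - (S i).B) :
    HaltsWithin N (posteriorProgram d) (input L S x) (100 * t)
      (HoldsPosterior N (bandwidth d L t) S x) := by
  have hk := successCount_le_neighborCount N (bandwidth d L t) S x
  have hn : neighborCount N (bandwidth d L t) S x ≤ t :=
    (Finset.card_le_univ _).trans_eq (Fintype.card_fin t)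
  set Δ := bandwidth d L t with hΔ
  set n := neighborCount N Δ S x with hn'
  set k := successCount N Δ S x with hk'
  -- The total is `12t + 3n + 15k + 45`, at most `75t` because `k ≤ n ≤ t` and `1 ≤ t`.
  refine HaltsWithin.mono (T := 6 + ((t * 12 + 1) + (((n + 1) * 3 + 6) +
    (((k + 1) * 10 + 10) + ((k + 1) * 5 + 4))))) (.seq <|
    (haltsWithin_bandwidthProgram N L S x).mono le_rfl fun m₁ h₁ => .seq <|
    (haltsWithin_scan N Δ L S x h₁).mono le_rfl fun m₂ h₂ => .seq <|
    (haltsWithin_clearProgram (n := n) (k := k) (B := meanB N Δ S x) ?_ ?_ ?_).mono le_rfl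
      fun m₃ h₃ => .seq <|
    (haltsWithin_weightProgram hk h₃).mono le_rfl fun m₄ h₄ =>
    haltsWithin_normalizeProgram h₄) (by omega) ?_
  · rw [h₂.idx_two, prefixNeighbors_self]; rfl
  · rw [h₂.idx_three, prefixNeighbors_self]; rfl
  · rw [h₂.reg_three, prefixNeighbors_self]; rfl
  · rintro m ⟨h0, harr⟩
    refine ⟨h0, fun i hi => ?_⟩
    rw [harr i hi, coeff_eq_relWeight N Δ S x hA hi]

end CSBP

theorem theorem4 (d : ℕ) (N : Seminorm ℝ (Fin d → ℝ)) (hN : ∀ v, N v = 0 → v = 0) :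
    (∃ c : ℝ → ℝ → ℝ, ∀ (t : ℕ) (L : ℝ) (π : (Fin d → ℝ) → ℝ) (B : Fin t → ℝ) (σ : ℝ)
        (Ω : Type*) [MeasurableSpace Ω] (P : Measure Ω) [IsProbabilityMeasure P]
        (X : Fin t → Ω → Fin d → ℝ) (ε : Fin t → Ω → ℝ) (s : Fin t → Ω → Bool),
        0 < L → 1 ≤ L ^ 2 * t →
        (∀ x ∈ Set.Icc (0 : Fin d → ℝ) 1, 0 < π x ∧ π x ≤ 1) →
        (∀ x ∈ Set.Icc (0 : Fin d → ℝ) 1, ∀ y ∈ Set.Icc (0 : Fin d → ℝ) 1,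
          |π x - π y| ≤ L * N (x - y)) →
        (∀ i, 0 ≤ B i ∧ B i ≤ 1) → (∑ i, B i) / t < 1 →
        CSBP.NoisyModel P π B σ X ε s →
        ∀ x ∈ Set.Icc (0 : Fin d → ℝ) 1,
          ∫⁻ ω, ∫⁻ θ, ENNReal.ofReal ((θ - π x) ^ 2)
              ∂(CSBP.posterior N (CSBP.bandwidth d L t)
                (fun i => ⟨X i ω, s i ω, 1 - B i, B i⟩) x (fun _ => 1) (fun _ => 1)) ∂P ≤
            ENNReal.ofReal (c ((∑ i, B i) / t) (σ ^ 2) *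
              L ^ (2 * (d : ℝ) / ((d : ℝ) + 2)) * (t : ℝ) ^ (-2 / ((d : ℝ) + 2)))) ∧
    (∃ (Q : CSBP.Program) (K : ℕ), ∀ (t : ℕ) (L : ℝ) (S : Fin t → CSBP.Experiment d)
        (x : Fin d → ℝ), 1 ≤ t → 0 < L → (∀ i, 0 ≤ (S i).B ∧ (S i).B ≤ 1) →
        (∀ i, (S i).A = 1 - (S i).B) → x ∈ Set.Icc (0 : Fin d → ℝ) 1 →
        ∃ (n : ℕ) (m : CSBP.Memory d), n ≤ K * t ∧
          CSBP.Runs N Q (CSBP.input L S x) n m ∧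
          CSBP.HoldsPosterior N (CSBP.bandwidth d L t) S x m) := by
  refine ⟨CSBP.exists_risk_bound d N, CSBP.posteriorProgram d, 100, ?_⟩
  intro t L S x ht _ _ hA _
  exact CSBP.haltsWithin_posteriorProgram N L S x ht hA
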